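/- Let $X$ be a compact smooth manifold with nonempty boundary, of dimension $d\ge 1$, with interior $X^\circ$. Let $x\in C^\infty(X;[0,\infty))$ be a boundary-defining function and let $\iota:[0,\bar x)_x\times\partial X\to X$ (with $\bar x>0$) be a boundary collar whose first coordinate is $x$. For $k\in\mathbb R$, let $S^k(X)=x^{-k}S^0(X)$, where $S^0(X)$ is the space of functions $a\in C^\infty(X^\circ)$ such that, near $\partial X$, all derivatives of $a$ built from $x\partial_x$ and from $\partial_y$ (for local coordinates $y$ on $\partial X$) are bounded; $S^0([0,\bar x);\,\cdot\,)$ denotes families of tensors on $\partial X$ whose components have this property as $x\to 0$. Fix $\delta\in(0,1]$, $\mathsf M\in\mathbb R$, $\aleph\in\mathbb R$, $m>0$, real-valued $\beth\in S^0(X)$ and $V\in S^{-1-\delta}(X)$, and a Riemannian metric $g_X$ on $X^\circ$ that in the collar has the form $$g_X=\Big(\frac1{x^4}+\frac{\mathsf M}{x^3}\Big)\,dx^2+\frac{h_{\partial X}}{x^2}+\frac{\Gamma_1\odot dx}{x^2}+\frac{h_1}{x}+x^{1+\delta}h_X,$$ where $h_{\partial X}$ is a Riemannian metric on $\partial X$,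 $\Gamma_1\in S^0([0,\bar x);\Omega^1(\partial X))$, $h_1\in S^0([0,\bar x);C^\infty(\partial X;\operatorname{Sym}^2T^*\partial X))$, and $h_X$ is a symmetric $2$-tensor whose coefficients with respect to the frame $dx/x^2,\ dy_i/x$ are symbols of order $0$. Assume that $f:=1+x\aleph+x^{1+\delta}\beth>0$ on $X^\circ$. With $\triangle$ the positive semidefinite Laplace--Beltrami operator and $\nabla$ the gradient of $g_X$, let $$P=f\,\triangle-\tfrac12\big(x^{1+\delta}\nabla\beth+(\aleph+(1+\delta)x^\delta\beth)\nabla x\big)+x m^2\aleph+x^{1+\delta}m^2\beth+fV,$$ and let $\mathcal H=L^2(X,\,f^{-1/2}\,d\mathrm{Vol}_{g_X})$. If $\aleph<0$, then there is an infinite sequence of real-valued functions $v_1,v_2,\dots\in C_c^\infty(X^\circ)$ with pairwise disjoint supports such that $\langle v_n,Pv_n\rangle_{\mathcal H}<0$ for all $n$. -/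

import Mathlib

open scoped Manifold ContDiff Topology
open Set MeasureTheory

namespace AsympConic

noncomputable section

/-! ### Symbols (conormal functions) on a collar -/

section Symbols

variable {n : ℕ} {Y : Type*} [TopologicalSpace Y] [ChartedSpace (EuclideanSpace ℝ (Fin n)) Y]

/-- `b(s, z)` is a symbol of order `0` on `[0, xbar)_s × U`, for `U` an open set of `ℝⁿ`: it is smooth
for `s > 0`, and all its derivatives built from `s ∂_s` and `∂_z` are bounded on
`(0, s₀] × K` for each `s₀ < xbar` and each compact `K ⊆ U`. Since `s ∂_s = - ∂_t` for
`t = - log s`, this says that all `(t, z)`-derivatives of `b(exp (-t), z)` are bounded there. -/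
def IsSymbolOn (xbar : ℝ) (U : Set (EuclideanSpace ℝ (Fin n)))
    (b : ℝ → EuclideanSpace ℝ (Fin n) → ℝ) : Prop :=
  ContDiffOn ℝ ∞ (fun q : ℝ × EuclideanSpace ℝ (Fin n) => b q.1 q.2) (Ioo 0 xbar ×ˢ U) ∧
  ∀ K ⊆ U, IsCompact K → ∀ s₀ ∈ Ioo 0 xbar, ∀ k : ℕ, ∃ C : ℝ, ∀ s ∈ Ioc 0 s₀, ∀ z ∈ K,
    ‖iteratedFDeriv ℝ k
      (fun q : ℝ × EuclideanSpace ℝ (Fin n) => b (Real.exp (-q.1)) q.2) (-Real.log s, z)‖ ≤ C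

/-- `S⁰([0, xbar); C^∞(Y))`. -/
def IsScalarSymbol (xbar : ℝ) (a : ℝ → Y → ℝ) : Prop :=
  ∀ e ∈ atlas (EuclideanSpace ℝ (Fin n)) Y, IsSymbolOn xbar e.target fun s z => a s (e.symm z)

/-- `S⁰([0, xbar); Ω¹(Y))`: the components in every chart are symbols. -/
def IsOneFormSymbol (xbar : ℝ) (Γ : ℝ → ∀ y : Y, TangentSpace (𝓡 n) y →L[ℝ] ℝ) : Prop :=
  ∀ e ∈ atlas (EuclideanSpace ℝ (Fin n)) Y, ∀ v : EuclideanSpace ℝ (Fin n),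
    IsSymbolOn xbar e.target fun s z =>
      Γ s (e.symm z) (mfderiv (𝓡 n) (𝓡 n) e.symm z v)

/-- `S⁰([0, xbar); C^∞(Y; Sym² T*Y))`: symmetric, and the components in every chart are symbols. -/
def IsSymTwoTensorSymbol (xbar : ℝ)
    (H : ℝ → ∀ y : Y, TangentSpace (𝓡 n) y →L[ℝ] TangentSpace (𝓡 n) y →L[ℝ] ℝ) : Prop :=
  (∀ s y v w, H s y v w = H s y w v) ∧
  ∀ e ∈ atlas (EuclideanSpace ℝ (Fin n)) Y, ∀ v w : EuclideanSpace ℝ (Fin n),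
    IsSymbolOn xbar e.target fun s z =>
      H s (e.symm z) (mfderiv (𝓡 n) (𝓡 n) e.symm z v) (mfderiv (𝓡 n) (𝓡 n) e.symm z w)

end Symbols

/-! ### Manifolds with boundary, collars, metrics on the interior -/

variable {n : ℕ}
  {X : Type*} [TopologicalSpace X] [ChartedSpace (EuclideanHalfSpace (n + 1)) X]
  {Y : Type*} [TopologicalSpace Y] [ChartedSpace (EuclideanSpace ℝ (Fin n)) Y]

/-- `x ∈ C^∞(X; [0, ∞))` vanishes exactly on `∂X`, and `dx ≠ 0` there. -/
structure IsBoundaryDefining (x : X → ℝ) : Prop where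
  smooth : ContMDiff (𝓡∂ (n + 1)) 𝓘(ℝ, ℝ) ∞ x
  nonneg : ∀ p, 0 ≤ x p
  eq_zero_iff : ∀ p, x p = 0 ↔ p ∈ (𝓡∂ (n + 1)).boundary X
  deriv_ne_zero : ∀ p ∈ (𝓡∂ (n + 1)).boundary X, mfderiv (𝓡∂ (n + 1)) 𝓘(ℝ, ℝ) x p ≠ 0

/-- A boundary collar `ι : [0, xbar)_x × ∂X → X`: a diffeomorphism of `[0, xbar) × Y` onto an open
neighbourhood of `∂X` whose first coordinate is `x`. In particular `y ↦ ι (0, y)` identifies the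
closed manifold `Y` with `∂X`. -/
structure Collar (n : ℕ) {X : Type*} [TopologicalSpace X]
    [ChartedSpace (EuclideanHalfSpace (n + 1)) X]
    (Y : Type*) [TopologicalSpace Y] [ChartedSpace (EuclideanSpace ℝ (Fin n)) Y]
    (x : X → ℝ) (xbar : ℝ) extends PartialEquiv (ℝ × Y) X where
  source_eq : source = Ico 0 xbar ×ˢ univ
  open_target : IsOpen target
  boundary_subset : (𝓡∂ (n + 1)).boundary X ⊆ target
  smooth_toFun : ContMDiffOn (𝓘(ℝ, ℝ).prod (𝓡 n)) (𝓡∂ (n + 1)) ∞ toFun source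
  smooth_invFun : ContMDiffOn (𝓡∂ (n + 1)) (𝓘(ℝ, ℝ).prod (𝓡 n)) ∞ invFun target
  x_eq : ∀ s ∈ Ico 0 xbar, ∀ y : Y, x (toFun (s, y)) = s

/-- A field of bilinear forms on the tangent spaces of `X` (only its values on the interior are
relevant). -/
abbrev FormField (n : ℕ) (X : Type*) [TopologicalSpace X]
    [ChartedSpace (EuclideanHalfSpace (n + 1)) X] : Type _ :=
  ∀ p : X, TangentSpace (𝓡∂ (n + 1)) p →L[ℝ] TangentSpace (𝓡∂ (n + 1)) p →L[ℝ] ℝ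

/-- `g` is a smooth Riemannian metric on the interior `X°`. -/
structure IsInteriorMetric [IsManifold (𝓡∂ (n + 1)) ∞ X] (g : FormField n X) : Prop where
  symm : ∀ p ∈ (𝓡∂ (n + 1)).interior X, ∀ v w, g p v w = g p w v
  pos : ∀ p ∈ (𝓡∂ (n + 1)).interior X, ∀ v, v ≠ 0 → 0 < g p v v
  smooth : ContMDiffOn (𝓡∂ (n + 1)) ((𝓡∂ (n + 1)).prod
      𝓘(ℝ, EuclideanSpace ℝ (Fin (n + 1)) →L[ℝ] EuclideanSpace ℝ (Fin (n + 1)) →L[ℝ] ℝ)) ∞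
    (fun p => Bundle.TotalSpace.mk'
      (EuclideanSpace ℝ (Fin (n + 1)) →L[ℝ] EuclideanSpace ℝ (Fin (n + 1)) →L[ℝ] ℝ)
      (E := fun p : X => TangentSpace (𝓡∂ (n + 1)) p →L[ℝ] TangentSpace (𝓡∂ (n + 1)) p →L[ℝ] ℝ)
      p (g p))
    ((𝓡∂ (n + 1)).interior X)

/-- `S^k(X) = x^{-k} S⁰(X)`: smooth functions on `X°` such that `x^k a` is a symbol of
order `0` in the collar. -/
def MemSymbol {x : X → ℝ} {xbar : ℝ} (ι : Collar n Y x xbar) (k : ℝ) (a : X → ℝ) : Prop :=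
  ContMDiffOn (𝓡∂ (n + 1)) 𝓘(ℝ, ℝ) ∞ a ((𝓡∂ (n + 1)).interior X) ∧
  IsScalarSymbol (n := n) (Y := Y) xbar fun s y => s ^ k * a (ι.toFun (s, y))

/-- In the collar,
`g = (x⁻⁴ + M x⁻³) dx² + x⁻² h + x⁻² Γ₁ ⊙ dx + x⁻¹ h₁ + x^{1+δ} h_X`,
with `Γ₁`, `h₁` symbolic families on the boundary, and with
`h_X = A (dx/x²)² + B ⊙ dx/x³ + C/x²` a symbolic section of the symmetric square of the
scattering cotangent bundle (whose frame is `dx/x²`, `dy/x`). -/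
def IsConicMetric [IsManifold (𝓡 n) ∞ Y] {x : X → ℝ} {xbar : ℝ} (ι : Collar n Y x xbar)
    (δ M : ℝ)
    (h : Bundle.ContMDiffRiemannianMetric (𝓡 n) ∞ (EuclideanSpace ℝ (Fin n))
      (fun y : Y => TangentSpace (𝓡 n) y))
    (g : FormField n X) : Prop :=
  ∃ (Γ₁ : ℝ → ∀ y : Y, TangentSpace (𝓡 n) y →L[ℝ] ℝ)
    (h₁ : ℝ → ∀ y : Y, TangentSpace (𝓡 n) y →L[ℝ] TangentSpace (𝓡 n) y →L[ℝ] ℝ)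
    (A : ℝ → Y → ℝ)
    (B : ℝ → ∀ y : Y, TangentSpace (𝓡 n) y →L[ℝ] ℝ)
    (C : ℝ → ∀ y : Y, TangentSpace (𝓡 n) y →L[ℝ] TangentSpace (𝓡 n) y →L[ℝ] ℝ),
    IsOneFormSymbol xbar Γ₁ ∧ IsSymTwoTensorSymbol xbar h₁ ∧
    IsScalarSymbol (n := n) xbar A ∧ IsOneFormSymbol xbar B ∧ IsSymTwoTensorSymbol xbar C ∧
    ∀ s ∈ Ioo 0 xbar, ∀ (y : Y) (a b : ℝ) (η ζ : TangentSpace (𝓡 n) y),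
      g (ι.toFun (s, y))
          (mfderiv (𝓘(ℝ, ℝ).prod (𝓡 n)) (𝓡∂ (n + 1)) ι.toFun (s, y)
            ((a, η) : ℝ × EuclideanSpace ℝ (Fin n)))
          (mfderiv (𝓘(ℝ, ℝ).prod (𝓡 n)) (𝓡∂ (n + 1)) ι.toFun (s, y)
            ((b, ζ) : ℝ × EuclideanSpace ℝ (Fin n)))
        = (1 / s ^ 4 + M / s ^ 3) * (a * b) + h.inner y η ζ / s ^ 2
          + (a * Γ₁ s y ζ + b * Γ₁ s y η) / s ^ 2 + h₁ s y η ζ / s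
          + s ^ (1 + δ) * (A s y * (a * b) / s ^ 4
              + (a * B s y ζ + b * B s y η) / s ^ 3 + C s y η ζ / s ^ 2)

/-! ### Riemannian volume, gradient pairing, Laplace--Beltrami operator -/

/-- The `i`-th coordinate vector field of the chart `e` at the point with coordinates `z`. -/
def coordVec (e : OpenPartialHomeomorph X (EuclideanHalfSpace (n + 1)))
    (z : EuclideanSpace ℝ (Fin (n + 1))) (i : Fin (n + 1)) :
    TangentSpace (𝓡∂ (n + 1)) ((e.extend (𝓡∂ (n + 1))).symm z) :=
  mfderivWithin 𝓘(ℝ, EuclideanSpace ℝ (Fin (n + 1))) (𝓡∂ (n + 1))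
    (e.extend (𝓡∂ (n + 1))).symm (range (𝓡∂ (n + 1))) z (EuclideanSpace.single i (1 : ℝ))

/-- The matrix `(g_ij)` of `g` in the chart `e`, at the point with coordinates `z`. -/
def gram (g : FormField n X) (e : OpenPartialHomeomorph X (EuclideanHalfSpace (n + 1)))
    (z : EuclideanSpace ℝ (Fin (n + 1))) : Matrix (Fin (n + 1)) (Fin (n + 1)) ℝ :=
  Matrix.of fun i j =>
    g ((e.extend (𝓡∂ (n + 1))).symm z) (coordVec e z i) (coordVec e z j)

/-- The part of the Riemannian volume of `g` in the domain of the chart `e`: the measure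
`|det (g_ij)|^{1/2} dz`, transported to the interior points in the domain of `e`. -/
def chartVolume [MeasurableSpace X] (g : FormField n X)
    (e : OpenPartialHomeomorph X (EuclideanHalfSpace (n + 1))) : Measure X :=
  (((volume : Measure (EuclideanSpace ℝ (Fin (n + 1)))).restrict
      ((e.extend (𝓡∂ (n + 1))).target ∩
        (e.extend (𝓡∂ (n + 1))).symm ⁻¹' (𝓡∂ (n + 1)).interior X)).withDensity
    fun z => ENNReal.ofReal (Real.sqrt (gram g e z).det)).map (e.extend (𝓡∂ (n + 1))).symm

/-- The Riemannian volume measure of `(X°, g)`: the smallest measure that is at least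
`|det (g_ij)|^{1/2} dz` in every chart. As these local measures agree on overlaps, it is equal to
`|det (g_ij)|^{1/2} dz` in every chart; it gives no mass to `∂X`. -/
def riemannianVolume [MeasurableSpace X] (g : FormField n X) : Measure X :=
  ⨆ e ∈ atlas (EuclideanHalfSpace (n + 1)) X, chartVolume g e

/-- `∑ g^{jk} ∂_j u ∂_k w` at `z ∈ ℝᵈ`, for a metric with matrix `G`. -/
def coordGradPairing (G : EuclideanSpace ℝ (Fin (n + 1)) → Matrix (Fin (n + 1)) (Fin (n + 1)) ℝ)
    (u w : EuclideanSpace ℝ (Fin (n + 1)) → ℝ) (z : EuclideanSpace ℝ (Fin (n + 1))) : ℝ :=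
  ∑ j, ∑ k, (G z)⁻¹ j k * fderiv ℝ u z (EuclideanSpace.single j (1 : ℝ))
    * fderiv ℝ w z (EuclideanSpace.single k (1 : ℝ))

/-- `- |G|^{-1/2} ∑ ∂_j (|G|^{1/2} g^{jk} ∂_k u)` at `z ∈ ℝᵈ`, for a metric with matrix `G`. -/
def coordLaplacian (G : EuclideanSpace ℝ (Fin (n + 1)) → Matrix (Fin (n + 1)) (Fin (n + 1)) ℝ)
    (u : EuclideanSpace ℝ (Fin (n + 1)) → ℝ) (z : EuclideanSpace ℝ (Fin (n + 1))) : ℝ :=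
  -(Real.sqrt (G z).det)⁻¹ * ∑ j, fderiv ℝ
    (fun z' => ∑ k, Real.sqrt (G z').det * (G z')⁻¹ j k
      * fderiv ℝ u z' (EuclideanSpace.single k (1 : ℝ))) z (EuclideanSpace.single j (1 : ℝ))

/-- `(∇f) u = ⟨∇f, ∇u⟩_g` at the interior point `p`. -/
def gradPairing (g : FormField n X) (f u : X → ℝ) (p : X) : ℝ :=
  coordGradPairing (gram g (chartAt (EuclideanHalfSpace (n + 1)) p))
    (f ∘ (extChartAt (𝓡∂ (n + 1)) p).symm) (u ∘ (extChartAt (𝓡∂ (n + 1)) p).symm)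
    (extChartAt (𝓡∂ (n + 1)) p p)

/-- The (positive semidefinite) Laplace--Beltrami operator of `g` at the interior point `p`. -/
def laplacian (g : FormField n X) (u : X → ℝ) (p : X) : ℝ :=
  coordLaplacian (gram g (chartAt (EuclideanHalfSpace (n + 1)) p))
    (u ∘ (extChartAt (𝓡∂ (n + 1)) p).symm) (extChartAt (𝓡∂ (n + 1)) p p)

/-! ### The operator `P` and the inner product -/

/-- `1 + x ℵ + x^{1+δ} ℶ`. -/
def lapse (x : X → ℝ) (δ aleph : ℝ) (beth : X → ℝ) (p : X) : ℝ :=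
  1 + x p * aleph + x p ^ (1 + δ) * beth p

/-- `V_eff = x m² ℵ + x^{1+δ} m² ℶ + (1 + x ℵ + x^{1+δ} ℶ) V`. -/
def effPotential (x : X → ℝ) (δ aleph m : ℝ) (beth V : X → ℝ) (p : X) : ℝ :=
  x p * m ^ 2 * aleph + x p ^ (1 + δ) * m ^ 2 * beth p + lapse x δ aleph beth p * V p

/-- `P = (1 + x ℵ + x^{1+δ} ℶ) Δ - ½ (x^{1+δ} ∇ℶ + (ℵ + (1+δ) x^δ ℶ) ∇x) + V_eff`. -/
def opP (g : FormField n X) (x : X → ℝ) (δ aleph m : ℝ) (beth V : X → ℝ)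
    (u : X → ℝ) (p : X) : ℝ :=
  lapse x δ aleph beth p * laplacian g u p
    - 1 / 2 * (x p ^ (1 + δ) * gradPairing g beth u p
        + (aleph + (1 + δ) * x p ^ δ * beth p) * gradPairing g x u p)
    + effPotential x δ aleph m beth V p * u p

/-- The measure `(1 + x ℵ + x^{1+δ} ℶ)^{-1/2} dVol_g`. -/
def weightedVolume [MeasurableSpace X] (g : FormField n X) (x : X → ℝ) (δ aleph : ℝ)
    (beth : X → ℝ) : Measure X :=
  (riemannianVolume g).withDensity fun p =>
    ENNReal.ofReal (lapse x δ aleph beth p ^ (-(1 / 2 : ℝ)))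

/-- The `L²(X, μ)` inner product of real-valued functions. -/
def innerL2 [MeasurableSpace X] (μ : Measure X) (u w : X → ℝ) : ℝ :=
  ∫ p, u p * w p ∂μ

end

end AsympConic

open AsympConic

namespace AsympConic

/-! The potential of $P$ is attractive and long range: it behaves like $m^2\aleph x$ with
$\aleph<0$, while $V$ and the $\beth$ term are $O(x^{1+\delta})$. The first-order part of $P$ is
exactly $-\frac12\langle\nabla f,\nabla\,\cdot\,\rangle$, and integration by parts against the
weight $f^{-1/2}$ cancels it, so that $$\langle v,Pv\rangle_{\mathcal H}=\int \big(f^{1/2}|\nabla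
v|^2+f^{-1/2}V_{\mathrm{eff}}\,v^2\big)\,d\mathrm{Vol},$$ where $V_{\mathrm{eff}}$ is the
zeroth-order coefficient of $P$. Take a fixed bump $b$ on a box $(1,2)\times B$ and place it in the
collar at scale $\varepsilon$, in the coordinates $(x/\varepsilon,y)$. There $g_X$ is comparable
with $\varepsilon^{-2}$ times the Euclidean metric, uniformly in $\varepsilon$. Hence $|\nabla
v|^2=O(\varepsilon^2)$, whereas $V_{\mathrm{eff}}\le-\kappa\varepsilon$. The volume density is the
same power of $\varepsilon$ in both terms up to bounded factors, so the potential wins for small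
$\varepsilon$. For $\varepsilon=\eta 2^{-k}$ the supports lie in the disjoint shells
$\varepsilon<x<2\varepsilon$.

Only size bounds on the coefficients of $g_X$, $\beth$ and $V$ enter the estimate. The main
ingredients are `IsMetricOn.integral_energy` and `IsInteriorParam.innerL2_opP_eq` (the quadratic
form), `paramGram_collarParam_bounds` and `collarParam_lapse_potential_bounds` (uniform bounds at
scale $\varepsilon$), and `exists_forall_energy_neg` (the scaling argument). Since `laplacian` and
`gradPairing` are computed at each point in the preferred chart there, and `riemannianVolume` is a
supremum over charts, coordinate invariance of all three is needed before one can compute in the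
collar: `IsPullbackMetric.coordLaplacian_comp`, `IsPullbackMetric.coordGradPairing_comp`,
`IsInteriorParam.riemannianVolume_restrict`. -/

variable {n : ℕ}

local notation "𝔼[" n "]" => EuclideanSpace ℝ (Fin (n + 1))

/-! ### Metrics on open sets of Euclidean space -/

section Matrix

variable {ι F : Type*} [Fintype ι] [DecidableEq ι] [NormedAddCommGroup F] [NormedSpace ℝ F]

theorem contDiffOn_det {A : F → Matrix ι ι ℝ} {U : Set F}
    (hA : ∀ i j, ContDiffOn ℝ ∞ (fun z => A z i j) U) : ContDiffOn ℝ ∞ (fun z => (A z).det) U := by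
  simp only [Matrix.det_apply]
  exact ContDiffOn.sum fun σ _ => (contDiffOn_prod fun i _ => hA _ _).const_smul _

theorem contDiffOn_inv_apply {A : F → Matrix ι ι ℝ} {U : Set F}
    (hA : ∀ i j, ContDiffOn ℝ ∞ (fun z => A z i j) U) (hdet : ∀ z ∈ U, (A z).det ≠ 0) (i j : ι) :
    ContDiffOn ℝ ∞ (fun z => (A z)⁻¹ i j) U := by
  simp only [Matrix.inv_def, Ring.inverse_eq_inv, Matrix.smul_apply, Matrix.adjugate_apply,
    smul_eq_mul]
  refine ((contDiffOn_det hA).inv hdet).mul (contDiffOn_det fun k l => ?_)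
  by_cases hk : k = j
  · subst hk
    simpa using contDiffOn_const
  · simpa [Matrix.updateRow_ne hk] using hA k l

end Matrix

/-- `G` is the matrix of a smooth Riemannian metric on `U`. -/
structure IsMetricOn (G : 𝔼[n] → Matrix (Fin (n + 1)) (Fin (n + 1)) ℝ) (U : Set 𝔼[n]) : Prop where
  smooth : ∀ i j, ContDiffOn ℝ ∞ (fun z => G z i j) U
  posDef : ∀ z ∈ U, (G z).PosDef

/-- The vector of partial derivatives of `u` at `z`. -/
noncomputable def coordGrad (u : 𝔼[n] → ℝ) (z : 𝔼[n]) : Fin (n + 1) → ℝ :=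
  fun j => fderiv ℝ u z (EuclideanSpace.single j (1 : ℝ))

/-- The components of `|G|^{1/2} ∇u`. -/
noncomputable def gradFlux (G : 𝔼[n] → Matrix (Fin (n + 1)) (Fin (n + 1)) ℝ) (u : 𝔼[n] → ℝ)
    (j : Fin (n + 1)) (z : 𝔼[n]) : ℝ :=
  ∑ k, Real.sqrt (G z).det * (G z)⁻¹ j k * fderiv ℝ u z (EuclideanSpace.single k (1 : ℝ))

theorem coordLaplacian_eq (G : 𝔼[n] → Matrix (Fin (n + 1)) (Fin (n + 1)) ℝ) (u : 𝔼[n] → ℝ) (z : 𝔼[n]) :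
    coordLaplacian G u z = -(Real.sqrt (G z).det)⁻¹ *
      ∑ j, fderiv ℝ (gradFlux G u j) z (EuclideanSpace.single j (1 : ℝ)) := rfl

theorem coordGradPairing_eq (G : 𝔼[n] → Matrix (Fin (n + 1)) (Fin (n + 1)) ℝ) (u w : 𝔼[n] → ℝ) (z : 𝔼[n]) :
    coordGradPairing G u w z = coordGrad u z ⬝ᵥ ((G z)⁻¹).mulVec (coordGrad w z) := by
  simp only [coordGradPairing, coordGrad, dotProduct, Matrix.mulVec, Finset.mul_sum]
  refine Finset.sum_congr rfl fun j _ => Finset.sum_congr rfl fun k _ => by ring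

/-- The form suited to integration by parts: the density is absorbed in the flux, which is smooth
wherever the metric and $w$ are. -/
theorem sqrt_det_mul_coordGradPairing (G : 𝔼[n] → Matrix (Fin (n + 1)) (Fin (n + 1)) ℝ)
    (u w : 𝔼[n] → ℝ) (z : 𝔼[n]) :
    Real.sqrt (G z).det * coordGradPairing G u w z =
      ∑ j, fderiv ℝ u z (EuclideanSpace.single j (1 : ℝ)) * gradFlux G w j z := by
  simp only [coordGradPairing, gradFlux, Finset.mul_sum]
  refine Finset.sum_congr rfl fun j _ => Finset.sum_congr rfl fun k _ => by ring

theorem contDiffOn_fderiv_apply {F F' : Type*} [NormedAddCommGroup F] [NormedSpace ℝ F]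
    [NormedAddCommGroup F'] [NormedSpace ℝ F'] {u : F → F'} {U : Set F}
    (hU : IsOpen U) (hu : ContDiffOn ℝ ∞ u U) (v : F) :
    ContDiffOn ℝ ∞ (fun z => fderiv ℝ u z v) U :=
  (hu.fderiv_of_isOpen hU (by simp)).clm_apply contDiffOn_const

namespace IsMetricOn

variable {G : 𝔼[n] → Matrix (Fin (n + 1)) (Fin (n + 1)) ℝ} {U : Set 𝔼[n]}

theorem mono (hG : IsMetricOn G U) {V : Set 𝔼[n]} (h : V ⊆ U) : IsMetricOn G V :=
  ⟨fun i j => (hG.smooth i j).mono h, fun z hz => hG.posDef z (h hz)⟩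

theorem det_pos (hG : IsMetricOn G U) {z : 𝔼[n]} (hz : z ∈ U) : 0 < (G z).det := (hG.posDef z hz).det_pos

theorem contDiffOn_sqrt_det (hG : IsMetricOn G U) : ContDiffOn ℝ ∞ (fun z => Real.sqrt (G z).det) U :=
  (contDiffOn_det hG.smooth).sqrt fun _ hz => (hG.det_pos hz).ne'

theorem contDiffOn_gradFlux (hG : IsMetricOn G U) (hU : IsOpen U) {u : 𝔼[n] → ℝ} (hu : ContDiffOn ℝ ∞ u U)
    (j : Fin (n + 1)) : ContDiffOn ℝ ∞ (gradFlux G u j) U :=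
  ContDiffOn.sum fun k _ => ((hG.contDiffOn_sqrt_det).mul
    (contDiffOn_inv_apply hG.smooth (fun _ hz => (hG.det_pos hz).ne') j k)).mul
      (contDiffOn_fderiv_apply hU hu _)

theorem contDiffOn_coordGradPairing (hG : IsMetricOn G U) (hU : IsOpen U) {u w : 𝔼[n] → ℝ} (hu : ContDiffOn ℝ ∞ u U)
    (hw : ContDiffOn ℝ ∞ w U) : ContDiffOn ℝ ∞ (coordGradPairing G u w) U :=
  ContDiffOn.sum fun j _ => ContDiffOn.sum fun k _ =>
    ((contDiffOn_inv_apply hG.smooth (fun _ hz => (hG.det_pos hz).ne') j k).mul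
      (contDiffOn_fderiv_apply hU hu _)).mul (contDiffOn_fderiv_apply hU hw _)

theorem contDiffOn_coordLaplacian (hG : IsMetricOn G U) (hU : IsOpen U) {u : 𝔼[n] → ℝ} (hu : ContDiffOn ℝ ∞ u U) :
    ContDiffOn ℝ ∞ (coordLaplacian G u) U :=
  ((hG.contDiffOn_sqrt_det).inv fun _ hz => (Real.sqrt_pos.2 (hG.det_pos hz)).ne').neg.mul
    (ContDiffOn.sum fun j _ => contDiffOn_fderiv_apply hU (hG.contDiffOn_gradFlux hU hu j) _)

end IsMetricOn

/-! ### Integration by parts -/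

/-- The product vanishes near every point outside the closed support of $f$, so the values of $g$
off $U$ do not matter. -/
theorem continuous_mul_of_tsupport_subset {F : Type*} [TopologicalSpace F] {f g : F → ℝ}
    {U : Set F} (hU : IsOpen U) (hf : Continuous f) (hfU : tsupport f ⊆ U)
    (hg : ContinuousOn g U) : Continuous fun z => f z * g z := by
  refine continuous_of_tsupport fun z hz => ?_
  have hz' : z ∈ U := hfU (tsupport_mul_subset_left hz)
  exact hf.continuousAt.mul (hg.continuousAt (hU.mem_nhds hz'))

theorem integrable_mul_of_tsupport_subset {F : Type*} [TopologicalSpace F] [MeasurableSpace F]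
    [OpensMeasurableSpace F] {μ : Measure F} [IsFiniteMeasureOnCompacts μ] {f g : F → ℝ}
    {U : Set F} (hU : IsOpen U) (hf : Continuous f) (hfc : HasCompactSupport f)
    (hfU : tsupport f ⊆ U) (hg : ContinuousOn g U) : Integrable (fun z => f z * g z) μ :=
  (continuous_mul_of_tsupport_subset hU hf hfU hg).integrable_of_hasCompactSupport hfc.mul_right

/-- The divergence theorem for $fZ$; the support of $f$ is compact in $U$, so there is no boundary
term. -/
theorem integral_mul_div_eq_neg {U : Set 𝔼[n]} (hU : IsOpen U) {f : 𝔼[n] → ℝ} (hf : ContDiff ℝ ∞ f)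
    (hfc : HasCompactSupport f) (hfU : tsupport f ⊆ U) {Z : Fin (n + 1) → 𝔼[n] → ℝ}
    (hZ : ∀ j, ContDiffOn ℝ ∞ (Z j) U) :
    ∫ z, f z * ∑ j, fderiv ℝ (Z j) z (EuclideanSpace.single j (1 : ℝ)) =
      -∫ z, ∑ j, fderiv ℝ f z (EuclideanSpace.single j (1 : ℝ)) * Z j z := by
  have i1 : ∀ j, Integrable fun z => f z * fderiv ℝ (Z j) z (EuclideanSpace.single j (1 : ℝ)) :=
    fun j => integrable_mul_of_tsupport_subset hU hf.continuous hfc hfU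
      (contDiffOn_fderiv_apply hU (hZ j) _).continuousOn
  have i2 : ∀ j, Integrable fun z => fderiv ℝ f z (EuclideanSpace.single j (1 : ℝ)) * Z j z :=
    fun j => integrable_mul_of_tsupport_subset hU
      (hf.continuous_fderiv_apply (by simp) |>.comp (continuous_id.prodMk continuous_const))
      (hfc.fderiv_apply ℝ _) ((tsupport_fderiv_apply_subset ℝ _).trans hfU) (hZ j).continuousOn
  simp only [Finset.mul_sum]
  rw [integral_finsetSum _ fun j _ => i1 j, integral_finsetSum _ fun j _ => i2 j,
    ← Finset.sum_neg_distrib]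
  refine Finset.sum_congr rfl fun j _ => ?_
  refine integral_mul_fderiv_eq_neg_fderiv_mul_of_integrable (i2 j) (i1 j)
    (integrable_mul_of_tsupport_subset hU hf.continuous hfc hfU (hZ j).continuousOn)
    (fun z _ => hf.differentiable (by simp) z) fun z hz =>
      ((hZ j).contDiffAt (hU.mem_nhds (hfU hz))).differentiableAt (by simp)

/-- Green's formula: the density $|G|^{1/2}$ cancels the prefactor of the Laplacian and leaves the
divergence of the flux. -/
theorem IsMetricOn.integral_mul_coordLaplacian {G : 𝔼[n] → Matrix (Fin (n + 1)) (Fin (n + 1)) ℝ}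
    {U : Set 𝔼[n]} (hG : IsMetricOn G U) (hU : IsOpen U) {f u : 𝔼[n] → ℝ} (hf : ContDiff ℝ ∞ f)
    (hfc : HasCompactSupport f) (hfU : tsupport f ⊆ U) (hu : ContDiffOn ℝ ∞ u U) :
    ∫ z in U, Real.sqrt (G z).det * (f z * coordLaplacian G u z) =
      ∫ z in U, Real.sqrt (G z).det * coordGradPairing G f u z := by
  have h := integral_mul_div_eq_neg hU hf hfc hfU (hG.contDiffOn_gradFlux hU hu)
  have e1 : ∫ z in U, Real.sqrt (G z).det * coordGradPairing G f u z =
      ∫ z, ∑ j, fderiv ℝ f z (EuclideanSpace.single j (1 : ℝ)) * gradFlux G u j z := by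
    simp only [sqrt_det_mul_coordGradPairing]
    refine setIntegral_eq_integral_of_forall_compl_eq_zero fun z hz => ?_
    have : fderiv ℝ f z = 0 := by
      by_contra h0
      exact hz (hfU (support_fderiv_subset ℝ (Function.mem_support.2 h0)))
    simp [this]
  have e2 : ∫ z in U, Real.sqrt (G z).det * (f z * coordLaplacian G u z) =
      -∫ z in U, f z * ∑ j, fderiv ℝ (gradFlux G u j) z (EuclideanSpace.single j (1 : ℝ)) := by
    rw [← integral_neg]
    refine setIntegral_congr_fun hU.measurableSet fun z hz => ?_
    have := (Real.sqrt_pos.2 (hG.det_pos hz)).ne'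
    simp only [coordLaplacian_eq]
    field_simp
  have e3 : ∫ z in U, f z * ∑ j, fderiv ℝ (gradFlux G u j) z (EuclideanSpace.single j (1 : ℝ)) =
      ∫ z, f z * ∑ j, fderiv ℝ (gradFlux G u j) z (EuclideanSpace.single j (1 : ℝ)) := by
    refine setIntegral_eq_integral_of_forall_compl_eq_zero fun z hz => ?_
    have : f z = 0 := by
      by_contra h0
      exact hz (hfU (subset_tsupport _ h0))
    simp [this]
  rw [e1, e2, e3, h, neg_neg]

/-! ### Transport of compactly supported functions -/

/-- The function `b ∘ ψ` on `A`, extended by zero. -/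
noncomputable def extendZero {N F : Type*} (A : Set N) (ψ : N → F) (b : F → ℝ) : N → ℝ :=
  A.indicator (b ∘ ψ)

theorem extendZero_apply_of_mem {N F : Type*} {A : Set N} {ψ : N → F} {b : F → ℝ} {p : N}
    (hp : p ∈ A) : extendZero A ψ b p = b (ψ p) := indicator_of_mem hp _

section Transport

variable {N F : Type*} [TopologicalSpace F] {φ : F → N} {ψ : N → F} {Ω : Set F} {b : F → ℝ}

theorem extendZero_eq_zero (hinv : LeftInvOn ψ φ Ω) {p : N} (hp : p ∉ φ '' tsupport b) :
    extendZero (φ '' Ω) ψ b p = 0 := by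
  by_cases h : p ∈ φ '' Ω
  · rw [extendZero_apply_of_mem h]
    obtain ⟨z, hz, rfl⟩ := h
    rw [hinv hz]
    by_contra h0
    exact hp ⟨z, subset_tsupport _ h0, rfl⟩
  · exact indicator_of_notMem h _

variable [TopologicalSpace N]

theorem isCompact_image_tsupport (hφ : ContinuousOn φ Ω) (hb : HasCompactSupport b)
    (hbΩ : tsupport b ⊆ Ω) : IsCompact (φ '' tsupport b) :=
  IsCompact.image_of_continuousOn hb (hφ.mono hbΩ)

variable [T2Space N]

/-- The image of the compact support is compact, hence closed because the target is Hausdorff. -/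
theorem tsupport_extendZero_subset (hinv : LeftInvOn ψ φ Ω) (hφ : ContinuousOn φ Ω)
    (hb : HasCompactSupport b) (hbΩ : tsupport b ⊆ Ω) :
    tsupport (extendZero (φ '' Ω) ψ b) ⊆ φ '' tsupport b := by
  refine closure_minimal (fun p hp => ?_) (isCompact_image_tsupport hφ hb hbΩ).isClosed
  by_contra h
  exact hp (extendZero_eq_zero hinv h)

theorem hasCompactSupport_extendZero (hinv : LeftInvOn ψ φ Ω) (hφ : ContinuousOn φ Ω)
    (hb : HasCompactSupport b) (hbΩ : tsupport b ⊆ Ω) :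
    HasCompactSupport (extendZero (φ '' Ω) ψ b) :=
  (isCompact_image_tsupport hφ hb hbΩ).of_isClosed_subset (isClosed_tsupport _)
    (tsupport_extendZero_subset hinv hφ hb hbΩ)

end Transport

/-- Smoothness only has to be checked on the closed support, which lies in the open image, where the
extension is $b\circ\psi$. -/
theorem contMDiff_extendZero {E H N F : Type*} [NormedAddCommGroup E] [NormedSpace ℝ E]
    [TopologicalSpace H] {I : ModelWithCorners ℝ E H} [TopologicalSpace N] [T2Space N]
    [ChartedSpace H N] [NormedAddCommGroup F] [NormedSpace ℝ F]
    {φ : F → N} {ψ : N → F} {Ω : Set F} {b : F → ℝ} (hinv : LeftInvOn ψ φ Ω)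
    (hφ : ContinuousOn φ Ω) (hopen : IsOpen (φ '' Ω))
    (hψ : ContMDiffOn I 𝓘(ℝ, F) ∞ ψ (φ '' Ω)) (hb : ContDiff ℝ ∞ b) (hbc : HasCompactSupport b)
    (hbΩ : tsupport b ⊆ Ω) : ContMDiff I 𝓘(ℝ, ℝ) ∞ (extendZero (φ '' Ω) ψ b) := by
  refine contMDiff_of_tsupport fun p hp => ?_
  have hp' : p ∈ φ '' Ω := image_mono hbΩ (tsupport_extendZero_subset hinv hφ hbc hbΩ hp)
  have h1 : ContMDiffAt I 𝓘(ℝ, ℝ) ∞ (b ∘ ψ) p :=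
    (hb.contMDiff.contMDiffAt).comp p (hψ.contMDiffAt (hopen.mem_nhds hp'))
  refine h1.congr_of_eventuallyEq ?_
  filter_upwards [hopen.mem_nhds hp'] with q hq using extendZero_apply_of_mem hq

/-! ### Changes of coordinates -/

/-- `τ : U → V` is a diffeomorphism of open sets, with inverse `σ`. -/
structure IsDiffeoOn {F : Type*} [NormedAddCommGroup F] [NormedSpace ℝ F]
    (τ σ : F → F) (U V : Set F) : Prop where
  isOpen_left : IsOpen U
  isOpen_right : IsOpen V
  smooth : ContDiffOn ℝ ∞ τ U
  smooth_inv : ContDiffOn ℝ ∞ σ V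
  mapsTo : MapsTo τ U V
  mapsTo_inv : MapsTo σ V U
  leftInv : LeftInvOn σ τ U
  rightInv : LeftInvOn τ σ V

theorem IsDiffeoOn.image_eq {F : Type*} [NormedAddCommGroup F] [NormedSpace ℝ F]
    {τ σ : F → F} {U V : Set F} (h : IsDiffeoOn τ σ U V) : τ '' U = V :=
  Subset.antisymm (image_subset_iff.2 h.mapsTo) fun w hw => ⟨σ w, h.mapsTo_inv hw, h.rightInv hw⟩

theorem IsDiffeoOn.differentiableAt {F : Type*} [NormedAddCommGroup F] [NormedSpace ℝ F]
    {τ σ : F → F} {U V : Set F} (h : IsDiffeoOn τ σ U V) {z : F} (hz : z ∈ U) :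
    DifferentiableAt ℝ τ z :=
  (h.smooth.contDiffAt (h.isOpen_left.mem_nhds hz)).differentiableAt (by simp)

/-- The matrix of partial derivatives of `τ` at `z`. -/
noncomputable def jacobianMatrix (τ : 𝔼[n] → 𝔼[n]) (z : 𝔼[n]) :
    Matrix (Fin (n + 1)) (Fin (n + 1)) ℝ :=
  Matrix.of fun k i => fderiv ℝ τ z (EuclideanSpace.single i (1 : ℝ)) k

theorem det_jacobianMatrix (τ : 𝔼[n] → 𝔼[n]) (z : 𝔼[n]) :
    (jacobianMatrix τ z).det = (fderiv ℝ τ z).det := by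
  rw [ContinuousLinearMap.det, ← LinearMap.det_toMatrix
    (EuclideanSpace.basisFun (Fin (n + 1)) ℝ).toBasis]
  congr 1

theorem coordGrad_comp {τ : 𝔼[n] → 𝔼[n]} {u : 𝔼[n] → ℝ} {z : 𝔼[n]}
    (hτ : DifferentiableAt ℝ τ z) (hu : DifferentiableAt ℝ u (τ z)) :
    coordGrad (u ∘ τ) z = (jacobianMatrix τ z).transpose.mulVec (coordGrad u (τ z)) := by
  ext i
  simp only [coordGrad, fderiv_comp z hu hτ, ContinuousLinearMap.comp_apply, Matrix.mulVec,
    dotProduct, jacobianMatrix, Matrix.transpose_apply, Matrix.of_apply]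
  conv_lhs => rw [← (EuclideanSpace.basisFun (Fin (n + 1)) ℝ).sum_repr
    (fderiv ℝ τ z (EuclideanSpace.single i (1 : ℝ)))]
  simp [map_sum]

/-- In coordinates related by `τ`, `G₁` and `G₂` are the matrices of the same metric. -/
structure IsPullbackMetric (G₁ G₂ : 𝔼[n] → Matrix (Fin (n + 1)) (Fin (n + 1)) ℝ)
    (τ σ : 𝔼[n] → 𝔼[n]) (U V : Set 𝔼[n]) : Prop where
  diffeo : IsDiffeoOn τ σ U V
  left : IsMetricOn G₁ U
  right : IsMetricOn G₂ V
  eq : ∀ z ∈ U, G₁ z = (jacobianMatrix τ z).transpose * G₂ (τ z) * jacobianMatrix τ z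

namespace IsPullbackMetric

variable {G₁ G₂ : 𝔼[n] → Matrix (Fin (n + 1)) (Fin (n + 1)) ℝ} {τ σ : 𝔼[n] → 𝔼[n]}
  {U V : Set 𝔼[n]}

theorem det_eq (h : IsPullbackMetric G₁ G₂ τ σ U V) {z : 𝔼[n]} (hz : z ∈ U) :
    (G₁ z).det = (fderiv ℝ τ z).det ^ 2 * (G₂ (τ z)).det := by
  rw [h.eq z hz, Matrix.det_mul, Matrix.det_mul, Matrix.det_transpose, det_jacobianMatrix]
  ring

theorem sqrt_det_eq (h : IsPullbackMetric G₁ G₂ τ σ U V) {z : 𝔼[n]} (hz : z ∈ U) :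
    Real.sqrt (G₁ z).det = |(fderiv ℝ τ z).det| * Real.sqrt (G₂ (τ z)).det := by
  rw [h.det_eq hz, Real.sqrt_mul (sq_nonneg _), Real.sqrt_sq_eq_abs]

theorem det_ne_zero (h : IsPullbackMetric G₁ G₂ τ σ U V) {z : 𝔼[n]} (hz : z ∈ U) :
    (jacobianMatrix τ z).det ≠ 0 := by
  intro h0
  have := h.left.det_pos hz
  rw [h.det_eq hz, ← det_jacobianMatrix, h0] at this
  simp at this

/-- The covectors contribute $J^{T}$ and $J$, which cancel against
$(J^{T}GJ)^{-1}=J^{-1}G^{-1}J^{-T}$. -/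
theorem coordGradPairing_comp (h : IsPullbackMetric G₁ G₂ τ σ U V) {u w : 𝔼[n] → ℝ} {z : 𝔼[n]}
    (hz : z ∈ U) (hu : DifferentiableAt ℝ u (τ z)) (hw : DifferentiableAt ℝ w (τ z)) :
    coordGradPairing G₁ (u ∘ τ) (w ∘ τ) z = coordGradPairing G₂ u w (τ z) := by
  have hτ := h.diffeo.differentiableAt hz
  have hJ : IsUnit (jacobianMatrix τ z).det := (h.det_ne_zero hz).isUnit
  have hJt : IsUnit (jacobianMatrix τ z).transpose.det := by rwa [Matrix.det_transpose]
  rw [coordGradPairing_eq, coordGradPairing_eq, coordGrad_comp hτ hu, coordGrad_comp hτ hw,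
    h.eq z hz, Matrix.mul_inv_rev, Matrix.mul_inv_rev, Matrix.mulVec_mulVec,
    Matrix.mul_assoc, Matrix.mul_assoc, Matrix.nonsing_inv_mul _ hJt, Matrix.mul_one,
    Matrix.mulVec_transpose, ← Matrix.dotProduct_mulVec, Matrix.mulVec_mulVec, ← Matrix.mul_assoc,
    Matrix.mul_nonsing_inv _ hJ, Matrix.one_mul]

/-- The Jacobian factor of the change of variables is exactly the ratio of the two Riemannian
densities. -/
theorem setIntegral_comp (h : IsPullbackMetric G₁ G₂ τ σ U V) (f : 𝔼[n] → ℝ) :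
    ∫ z in U, Real.sqrt (G₁ z).det * f (τ z) = ∫ w in V, Real.sqrt (G₂ w).det * f w := by
  rw [← h.diffeo.image_eq, integral_image_eq_integral_abs_det_fderiv_smul volume
    h.diffeo.isOpen_left.measurableSet
    (fun z hz => (h.diffeo.differentiableAt hz).hasFDerivAt.hasFDerivWithinAt)
    h.diffeo.leftInv.injOn]
  refine setIntegral_congr_fun h.diffeo.isOpen_left.measurableSet fun z hz => ?_
  simp only [h.sqrt_det_eq hz, smul_eq_mul, mul_assoc]

theorem setLIntegral_comp (h : IsPullbackMetric G₁ G₂ τ σ U V) {S : Set 𝔼[n]} (hS : S ⊆ U)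
    (hSm : MeasurableSet S) :
    ∫⁻ z in S, ENNReal.ofReal (Real.sqrt (G₁ z).det) =
      ∫⁻ w in τ '' S, ENNReal.ofReal (Real.sqrt (G₂ w).det) := by
  rw [lintegral_image_eq_lintegral_abs_det_fderiv_mul volume hSm
    (fun z hz => (h.diffeo.differentiableAt (hS hz)).hasFDerivAt.hasFDerivWithinAt)
    (h.diffeo.leftInv.injOn.mono hS)]
  refine setLIntegral_congr_fun hSm fun z hz => ?_
  simp only [h.sqrt_det_eq (hS hz), ENNReal.ofReal_mul (abs_nonneg _)]

/-- The Laplacian does not depend on the coordinates. -/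
theorem coordLaplacian_comp (h : IsPullbackMetric G₁ G₂ τ σ U V) {u : 𝔼[n] → ℝ}
    (hu : ContDiffOn ℝ ∞ u V) {z : 𝔼[n]} (hz : z ∈ U) :
    coordLaplacian G₁ (u ∘ τ) z = coordLaplacian G₂ u (τ z) := by
  have hU := h.diffeo.isOpen_left
  have hV := h.diffeo.isOpen_right
  have huτ : ContDiffOn ℝ ∞ (u ∘ τ) U := hu.comp h.diffeo.smooth h.diffeo.mapsTo
  -- A weak argument replaces the second-order chain rule: the weighted difference of the two sides
  -- integrates to zero against every bump function, hence vanishes almost everywhere, hence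
  -- everywhere by continuity.
  set D : 𝔼[n] → ℝ := fun z => Real.sqrt (G₁ z).det *
    (coordLaplacian G₁ (u ∘ τ) z - coordLaplacian G₂ u (τ z)) with hD
  have c1 : ContinuousOn (fun z => Real.sqrt (G₁ z).det) U := h.left.contDiffOn_sqrt_det.continuousOn
  have c2 : ContinuousOn (coordLaplacian G₁ (u ∘ τ)) U :=
    (h.left.contDiffOn_coordLaplacian hU huτ).continuousOn
  have c3 : ContinuousOn (fun z => coordLaplacian G₂ u (τ z)) U :=
    (h.right.contDiffOn_coordLaplacian hV hu).continuousOn.comp h.diffeo.smooth.continuousOn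
      h.diffeo.mapsTo
  have hDc : ContinuousOn D U := c1.mul (c2.sub c3)
  have key : ∀ f : 𝔼[n] → ℝ, ContDiff ℝ ∞ f → HasCompactSupport f → tsupport f ⊆ U →
      ∫ z in U, f z * D z = 0 := by
    intro f hf hfc hfU
    set f' := extendZero (τ '' U) σ f with hf'
    have hopen : IsOpen (τ '' U) := by rw [h.diffeo.image_eq]; exact hV
    have hcont := h.diffeo.smooth.continuousOn
    have f'1 : ContDiff ℝ ∞ f' := contMDiff_iff_contDiff.1 <|
      contMDiff_extendZero h.diffeo.leftInv hcont hopen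
        (by rw [h.diffeo.image_eq]; exact h.diffeo.smooth_inv.contMDiffOn) hf hfc hfU
    have f'2 : HasCompactSupport f' := hasCompactSupport_extendZero h.diffeo.leftInv hcont hfc hfU
    have f'3 : tsupport f' ⊆ V := (tsupport_extendZero_subset h.diffeo.leftInv hcont hfc hfU).trans
      (((image_mono hfU)).trans h.diffeo.image_eq.subset)
    have f'4 : ∀ z ∈ U, f' (τ z) = f z := fun z hz => by
      rw [hf', extendZero_apply_of_mem (mem_image_of_mem _ hz), h.diffeo.leftInv hz]
    have g1 := h.left.integral_mul_coordLaplacian hU hf hfc hfU huτ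
    have g2 := h.right.integral_mul_coordLaplacian hV f'1 f'2 f'3 hu
    rw [← h.setIntegral_comp, ← h.setIntegral_comp] at g2
    -- Green's formula reduces the comparison to first-order pairings, whose invariance is already
    -- known.
    have g3 : ∫ z in U, Real.sqrt (G₁ z).det * coordGradPairing G₁ f (u ∘ τ) z =
        ∫ z in U, Real.sqrt (G₁ z).det * coordGradPairing G₂ f' u (τ z) := by
      refine setIntegral_congr_fun hU.measurableSet fun z hz => ?_
      have hd : DifferentiableAt ℝ u (τ z) :=
        (hu.contDiffAt (hV.mem_nhds (h.diffeo.mapsTo hz))).differentiableAt (by simp)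
      have e : coordGradPairing G₁ f (u ∘ τ) z = coordGradPairing G₁ (f' ∘ τ) (u ∘ τ) z := by
        have : f =ᶠ[𝓝 z] f' ∘ τ := by
          filter_upwards [hU.mem_nhds hz] with y hy using (f'4 y hy).symm
        simp only [coordGradPairing, this.fderiv_eq]
      simp only [e, h.coordGradPairing_comp hz (f'1.differentiable (by simp) _) hd]
    have i1 : IntegrableOn (fun z => Real.sqrt (G₁ z).det * (f z * coordLaplacian G₁ (u ∘ τ) z))
        U := by
      refine (integrable_mul_of_tsupport_subset hU hf.continuous hfc hfU
        (c1.mul c2)).integrableOn.congr_fun (fun z _ => ?_) hU.measurableSet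
      simp only [Pi.mul_apply]
      ring
    have i2 : IntegrableOn (fun z => Real.sqrt (G₁ z).det * (f z * coordLaplacian G₂ u (τ z)))
        U := by
      refine (integrable_mul_of_tsupport_subset hU hf.continuous hfc hfU
        (c1.mul c3)).integrableOn.congr_fun (fun z _ => ?_) hU.measurableSet
      simp only [Pi.mul_apply]
      ring
    have e0 : ∫ z in U, f z * D z =
        ∫ z in U, (Real.sqrt (G₁ z).det * (f z * coordLaplacian G₁ (u ∘ τ) z) -
          Real.sqrt (G₁ z).det * (f z * coordLaplacian G₂ u (τ z))) :=
      setIntegral_congr_fun hU.measurableSet fun z _ => by simp only [hD]; ring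
    rw [e0, integral_sub i1 i2, g1, g3, ← g2, sub_eq_zero]
    refine setIntegral_congr_fun hU.measurableSet fun z hz => ?_
    simp only [f'4 z hz]
  have hae : ∀ᵐ z ∂(volume : Measure 𝔼[n]), z ∈ U → D z = 0 := by
    refine hU.ae_eq_zero_of_integral_contDiff_smul_eq_zero
      (hDc.locallyIntegrableOn hU.measurableSet) fun f hf hfc hfU => ?_
    rw [← key f hf hfc hfU]
    refine (setIntegral_eq_integral_of_forall_compl_eq_zero fun z hz => ?_).symm
    rw [image_eq_zero_of_notMem_tsupport fun h => hz (hfU h), zero_smul]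
  have hD0 : D z = 0 := by
    have h1 : D =ᵐ[volume.restrict U] fun _ => 0 :=
      (ae_restrict_iff' hU.measurableSet).2 hae
    exact Measure.eqOn_open_of_ae_eq h1 hU hDc continuousOn_const hz
  have := (Real.sqrt_pos.2 (h.left.det_pos hz)).ne'
  simpa [hD, this, sub_eq_zero] using hD0

end IsPullbackMetric

section

/-! ### Parametrizations of open subsets of the interior -/

/-- The vectors $d\varphi_z a$ form a smooth section along $\varphi$, being values of the tangent
map on a constant field; contracting the smooth field $T$ with two such sections is smooth. -/
theorem contDiffOn_pullback_form {F : Type*} [NormedAddCommGroup F] [NormedSpace ℝ F]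
    {E : Type*} [NormedAddCommGroup E] [NormedSpace ℝ E] {H : Type*} [TopologicalSpace H]
    {I : ModelWithCorners ℝ E H} {N : Type*} [TopologicalSpace N] [ChartedSpace H N]
    [IsManifold I ∞ N]
    {T : ∀ p : N, TangentSpace I p →L[ℝ] TangentSpace I p →L[ℝ] ℝ} {S : Set N}
    (hT : ContMDiffOn I (I.prod 𝓘(ℝ, E →L[ℝ] E →L[ℝ] ℝ)) ∞
      (fun p => Bundle.TotalSpace.mk' (E →L[ℝ] E →L[ℝ] ℝ)
        (E := fun p : N => TangentSpace I p →L[ℝ] TangentSpace I p →L[ℝ] ℝ) p (T p)) S)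
    {φ : F → N} {Ω : Set F} (hΩ : IsOpen Ω) (hφ : ContMDiffOn 𝓘(ℝ, F) I ∞ φ Ω)
    (hS : MapsTo φ Ω S) (a b : F) :
    ContDiffOn ℝ ∞ (fun z => T (φ z) (mfderiv 𝓘(ℝ, F) I φ z a) (mfderiv 𝓘(ℝ, F) I φ z b)) Ω := by
  have hv : ∀ a : F, ContMDiffOn 𝓘(ℝ, F) I.tangent ∞
      (fun z => Bundle.TotalSpace.mk' E (E := (TangentSpace I : N → Type _)) (φ z)
        (mfderiv 𝓘(ℝ, F) I φ z a)) Ω := by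
    intro a
    have h1 := hφ.contMDiffOn_tangentMapWithin (m := ∞) (by simp) hΩ.uniqueMDiffOn
    have h2 : ContMDiffOn 𝓘(ℝ, F) 𝓘(ℝ, F).tangent ∞
      (fun z : F => Bundle.TotalSpace.mk' F (E := (TangentSpace 𝓘(ℝ, F) : F → Type _)) z a) Ω :=
      contMDiffOn_vectorSpace_iff_contDiffOn.2 contDiffOn_const
    refine (h1.comp h2 fun z hz => hz).congr fun z hz => ?_
    simp only [Function.comp, tangentMapWithin, mfderivWithin_of_isOpen hΩ hz]
  have := ContMDiffOn.clm_bundle_apply₂ (F₁ := E) (F₂ := E) (F₃ := ℝ)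
     (E₁ := (TangentSpace I : N → Type _)) (E₂ := (TangentSpace I : N → Type _))
     (E₃ := Bundle.Trivial N ℝ) (hT.comp hφ hS) (hv a) (hv b)
  intro z hz
  have := this z hz
  rw [Bundle.contMDiffWithinAt_totalSpace] at this
  exact contMDiffWithinAt_iff_contDiffWithinAt.1 this.2

variable {X : Type*} [TopologicalSpace X] [ChartedSpace (EuclideanHalfSpace (n + 1)) X]

/-- All tangent spaces have the same underlying space, so vectors can be kept fixed while the base
point is rewritten. -/
theorem form_congr (g : FormField n X) {p q : X} (h : p = q) (v w : 𝔼[n]) :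
    (g p : 𝔼[n] →L[ℝ] 𝔼[n] →L[ℝ] ℝ) v w = (g q : 𝔼[n] →L[ℝ] 𝔼[n] →L[ℝ] ℝ) v w := by
  subst h
  rfl

/-- `φ` is a diffeomorphism of `Ω ⊆ ℝᵈ` onto an open subset of the interior, with inverse `ψ`. -/
structure IsInteriorParam (φ : 𝔼[n] → X) (ψ : X → 𝔼[n]) (Ω : Set 𝔼[n]) : Prop where
  isOpen : IsOpen Ω
  isOpen_image : IsOpen (φ '' Ω)
  smooth : ContMDiffOn 𝓘(ℝ, 𝔼[n]) (𝓡∂ (n + 1)) ∞ φ Ω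
  smooth_inv : ContMDiffOn (𝓡∂ (n + 1)) 𝓘(ℝ, 𝔼[n]) ∞ ψ (φ '' Ω)
  leftInv : LeftInvOn ψ φ Ω
  mapsTo : MapsTo φ Ω ((𝓡∂ (n + 1)).interior X)

/-- The matrix of `g` in the coordinates given by `φ`. -/
noncomputable def paramGram (g : FormField n X) (φ : 𝔼[n] → X) (z : 𝔼[n]) :
    Matrix (Fin (n + 1)) (Fin (n + 1)) ℝ :=
  Matrix.of fun i j => g (φ z)
    (mfderiv 𝓘(ℝ, 𝔼[n]) (𝓡∂ (n + 1)) φ z (EuclideanSpace.single i (1 : ℝ)))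
    (mfderiv 𝓘(ℝ, 𝔼[n]) (𝓡∂ (n + 1)) φ z (EuclideanSpace.single j (1 : ℝ)))

theorem dotProduct_bilin_mulVec {W : Type*} [AddCommGroup W] [Module ℝ W] [TopologicalSpace W]
    (B : W →L[ℝ] W →L[ℝ] ℝ) (L : 𝔼[n] →L[ℝ] W) (a b : 𝔼[n]) :
    a.ofLp ⬝ᵥ (Matrix.of fun i j => B (L (EuclideanSpace.single i (1 : ℝ)))
      (L (EuclideanSpace.single j (1 : ℝ)))).mulVec b.ofLp = B (L a) (L b) := by
  conv_rhs => rw [← (EuclideanSpace.basisFun (Fin (n + 1)) ℝ).sum_repr a,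
    ← (EuclideanSpace.basisFun (Fin (n + 1)) ℝ).sum_repr b]
  simp only [dotProduct, Matrix.mulVec, Matrix.of_apply, map_sum, map_smul,
    sum_apply, smul_apply, smul_eq_mul,
    EuclideanSpace.basisFun_repr, EuclideanSpace.basisFun_apply, Finset.mul_sum]
  rw [Finset.sum_comm]
  exact Finset.sum_congr rfl fun i _ => Finset.sum_congr rfl fun j _ => by ring

theorem dotProduct_paramGram_mulVec (g : FormField n X) (φ : 𝔼[n] → X) (z a b : 𝔼[n]) :
    a.ofLp ⬝ᵥ (paramGram g φ z).mulVec b.ofLp =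
      g (φ z) (mfderiv 𝓘(ℝ, 𝔼[n]) (𝓡∂ (n + 1)) φ z a)
        (mfderiv 𝓘(ℝ, 𝔼[n]) (𝓡∂ (n + 1)) φ z b) :=
  dotProduct_bilin_mulVec (W := TangentSpace (𝓡∂ (n + 1)) (φ z)) (g (φ z))
    (mfderiv 𝓘(ℝ, 𝔼[n]) (𝓡∂ (n + 1)) φ z) a b

namespace IsInteriorParam

variable {φ φ₁ φ₂ : 𝔼[n] → X} {ψ ψ₁ ψ₂ : X → 𝔼[n]} {Ω Ω₁ Ω₂ : Set 𝔼[n]}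

theorem mdifferentiableAt (h : IsInteriorParam φ ψ Ω) {z : 𝔼[n]} (hz : z ∈ Ω) :
    MDifferentiableAt 𝓘(ℝ, 𝔼[n]) (𝓡∂ (n + 1)) φ z :=
  (h.smooth.contMDiffAt (h.isOpen.mem_nhds hz)).mdifferentiableAt (by simp)

theorem mdifferentiableAt_inv (h : IsInteriorParam φ ψ Ω) {p : X} (hp : p ∈ φ '' Ω) :
    MDifferentiableAt (𝓡∂ (n + 1)) 𝓘(ℝ, 𝔼[n]) ψ p :=
  (h.smooth_inv.contMDiffAt (h.isOpen_image.mem_nhds hp)).mdifferentiableAt (by simp)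

/-- Differentiate $\psi\circ\varphi=\mathrm{id}$. This is what makes the Gram matrix positive
definite in these coordinates. -/
theorem mfderiv_injective (h : IsInteriorParam φ ψ Ω) {z : 𝔼[n]} (hz : z ∈ Ω) :
    Function.Injective (mfderiv 𝓘(ℝ, 𝔼[n]) (𝓡∂ (n + 1)) φ z) := by
  have h1 : ψ ∘ φ =ᶠ[𝓝 z] id := by
    filter_upwards [h.isOpen.mem_nhds hz] with y hy using h.leftInv hy
  have h2 := mfderiv_comp z (h.mdifferentiableAt_inv (mem_image_of_mem φ hz))
    (h.mdifferentiableAt hz)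
  rw [h1.mfderiv_eq, mfderiv_id] at h2
  intro a b hab
  have h3 := congrArg (fun L => L a) h2
  have h4 := congrArg (fun L => L b) h2
  simp only [ContinuousLinearMap.comp_apply] at h3 h4
  rw [hab] at h3
  exact h3.trans h4.symm

theorem isMetricOn [IsManifold (𝓡∂ (n + 1)) ∞ X] (h : IsInteriorParam φ ψ Ω) {g : FormField n X}
    (hg : IsInteriorMetric g) : IsMetricOn (paramGram g φ) Ω where
  smooth i j := contDiffOn_pullback_form hg.smooth h.isOpen h.smooth h.mapsTo _ _
  posDef z hz := by
    refine Matrix.PosDef.of_dotProduct_mulVec_pos ?_ fun v hv => ?_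
    · ext i j
      exact hg.symm _ (h.mapsTo hz) _ _
    · have := dotProduct_paramGram_mulVec g φ z (WithLp.toLp 2 v) (WithLp.toLp 2 v)
      simp only [star_trivial]
      simp only at this
      rw [this]
      refine hg.pos _ (h.mapsTo hz) _ fun h0 => hv ?_
      have := h.mfderiv_injective hz (h0.trans (map_zero _).symm)
      exact congrArg WithLp.ofLp this

/-- The domain of the change of coordinates from `φ₁` to `φ₂` is open. -/
theorem isOpen_overlap (h₁ : IsInteriorParam φ₁ ψ₁ Ω₁) (h₂ : IsInteriorParam φ₂ ψ₂ Ω₂) :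
    IsOpen (Ω₁ ∩ φ₁ ⁻¹' (φ₂ '' Ω₂)) :=
  h₁.smooth.continuousOn.isOpen_inter_preimage h₁.isOpen h₂.isOpen_image

theorem comp_transition (h₂ : IsInteriorParam φ₂ ψ₂ Ω₂) {z : 𝔼[n]} (hz : φ₁ z ∈ φ₂ '' Ω₂) :
    φ₂ (ψ₂ (φ₁ z)) = φ₁ z := by
  obtain ⟨w, hw, e⟩ := hz
  rw [← e, h₂.leftInv hw]

theorem mapsTo_transition (h₂ : IsInteriorParam φ₂ ψ₂ Ω₂) :
    MapsTo (ψ₂ ∘ φ₁) (Ω₁ ∩ φ₁ ⁻¹' (φ₂ '' Ω₂)) (Ω₂ ∩ φ₂ ⁻¹' (φ₁ '' Ω₁)) := by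
  rintro z ⟨hz, hz'⟩
  refine ⟨?_, ?_⟩
  · obtain ⟨w, hw, e⟩ := hz'
    simpa only [Function.comp, ← e, h₂.leftInv hw] using hw
  · simp only [mem_preimage, Function.comp, h₂.comp_transition hz']
    exact mem_image_of_mem _ hz

theorem leftInvOn_transition (h₁ : IsInteriorParam φ₁ ψ₁ Ω₁) (h₂ : IsInteriorParam φ₂ ψ₂ Ω₂) :
    LeftInvOn (ψ₁ ∘ φ₂) (ψ₂ ∘ φ₁) (Ω₁ ∩ φ₁ ⁻¹' (φ₂ '' Ω₂)) := by
  rintro z ⟨hz, hz'⟩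
  simp only [Function.comp, h₂.comp_transition hz', h₁.leftInv hz]

theorem smooth_transition (h₁ : IsInteriorParam φ₁ ψ₁ Ω₁) (h₂ : IsInteriorParam φ₂ ψ₂ Ω₂) :
    ContDiffOn ℝ ∞ (ψ₂ ∘ φ₁) (Ω₁ ∩ φ₁ ⁻¹' (φ₂ '' Ω₂)) :=
  contMDiffOn_iff_contDiffOn.1 <|
    h₂.smooth_inv.comp (h₁.smooth.mono inter_subset_left) fun _ hz => hz.2

theorem isDiffeoOn_transition (h₁ : IsInteriorParam φ₁ ψ₁ Ω₁) (h₂ : IsInteriorParam φ₂ ψ₂ Ω₂) :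
    IsDiffeoOn (ψ₂ ∘ φ₁) (ψ₁ ∘ φ₂) (Ω₁ ∩ φ₁ ⁻¹' (φ₂ '' Ω₂)) (Ω₂ ∩ φ₂ ⁻¹' (φ₁ '' Ω₁)) where
  isOpen_left := h₁.isOpen_overlap h₂
  isOpen_right := h₂.isOpen_overlap h₁
  smooth := h₁.smooth_transition h₂
  smooth_inv := h₂.smooth_transition h₁
  mapsTo := h₂.mapsTo_transition
  mapsTo_inv := h₁.mapsTo_transition
  leftInv := h₁.leftInvOn_transition h₂
  rightInv := h₂.leftInvOn_transition h₁

/-- Near the point $\varphi_1=\varphi_2\circ\tau$ with $\tau=\psi_2\circ\varphi_1$; the chain rule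
$d\varphi_1=d\varphi_2\circ d\tau$ turns the Gram matrix into $J^{T}GJ$. -/
theorem isPullbackMetric [IsManifold (𝓡∂ (n + 1)) ∞ X] (h₁ : IsInteriorParam φ₁ ψ₁ Ω₁)
    (h₂ : IsInteriorParam φ₂ ψ₂ Ω₂) {g : FormField n X} (hg : IsInteriorMetric g) :
    IsPullbackMetric (paramGram g φ₁) (paramGram g φ₂) (ψ₂ ∘ φ₁) (ψ₁ ∘ φ₂)
      (Ω₁ ∩ φ₁ ⁻¹' (φ₂ '' Ω₂)) (Ω₂ ∩ φ₂ ⁻¹' (φ₁ '' Ω₁)) where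
  diffeo := h₁.isDiffeoOn_transition h₂
  left := (h₁.isMetricOn hg).mono inter_subset_left
  right := (h₂.isMetricOn hg).mono inter_subset_left
  eq z hz := by
    have hd := h₁.isDiffeoOn_transition h₂
    have hτ : DifferentiableAt ℝ (ψ₂ ∘ φ₁) z := hd.differentiableAt hz
    have h3 : φ₁ =ᶠ[𝓝 z] φ₂ ∘ (ψ₂ ∘ φ₁) := by
      filter_upwards [hd.isOpen_left.mem_nhds hz] with y hy using (h₂.comp_transition hy.2).symm
    have h4 := mfderiv_comp z (h₂.mdifferentiableAt (hd.mapsTo hz).1) hτ.mdifferentiableAt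
    rw [← h3.mfderiv_eq, mfderiv_eq_fderiv] at h4
    have h5 : ∀ a : 𝔼[n], (mfderiv 𝓘(ℝ, 𝔼[n]) (𝓡∂ (n + 1)) φ₁ z a : 𝔼[n]) =
        (mfderiv 𝓘(ℝ, 𝔼[n]) (𝓡∂ (n + 1)) φ₂ ((ψ₂ ∘ φ₁) z) (fderiv ℝ (ψ₂ ∘ φ₁) z a) : 𝔼[n]) :=
      fun a => congrArg (fun L : 𝔼[n] →L[ℝ] 𝔼[n] => L a) h4
    ext i j
    have e1 : ∀ i, ((jacobianMatrix (ψ₂ ∘ φ₁) z).col i) =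
        (fderiv ℝ (ψ₂ ∘ φ₁) z (EuclideanSpace.single i (1 : ℝ))).ofLp := fun i => rfl
    have e2 : ((jacobianMatrix (ψ₂ ∘ φ₁) z).transpose * paramGram g φ₂ ((ψ₂ ∘ φ₁) z) *
        jacobianMatrix (ψ₂ ∘ φ₁) z) i j =
        (jacobianMatrix (ψ₂ ∘ φ₁) z).col i ⬝ᵥ (paramGram g φ₂ ((ψ₂ ∘ φ₁) z)).mulVec
          ((jacobianMatrix (ψ₂ ∘ φ₁) z).col j) := by
      rw [Matrix.mul_assoc, Matrix.mul_apply]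
      rfl
    rw [e2, e1, e1, dotProduct_paramGram_mulVec]
    exact (form_congr g (h₂.comp_transition hz.2).symm _ _).trans
      (congrArg₂ (fun v w : 𝔼[n] => g (φ₂ ((ψ₂ ∘ φ₁) z)) v w) (h5 _) (h5 _))

end IsInteriorParam

end

section

variable {X : Type*} [TopologicalSpace X] [ChartedSpace (EuclideanHalfSpace (n + 1)) X]

/-! ### Charts as parametrizations -/

/-- The coordinates of the interior points in the domain of `e`. -/
def interiorTarget (e : OpenPartialHomeomorph X (EuclideanHalfSpace (n + 1))) : Set 𝔼[n] :=
  (e.extend (𝓡∂ (n + 1))).target ∩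
    (e.extend (𝓡∂ (n + 1))).symm ⁻¹' (𝓡∂ (n + 1)).interior X

theorem image_interiorTarget (e : OpenPartialHomeomorph X (EuclideanHalfSpace (n + 1))) :
    (e.extend (𝓡∂ (n + 1))).symm '' interiorTarget e =
      e.source ∩ (𝓡∂ (n + 1)).interior X := by
  ext p
  constructor
  · rintro ⟨z, ⟨hz, hz'⟩, rfl⟩
    exact ⟨by simpa only [e.extend_source] using (e.extend (𝓡∂ (n + 1))).map_target hz, hz'⟩
  · rintro ⟨hp, hp'⟩
    have hp0 : p ∈ (e.extend (𝓡∂ (n + 1))).source := by rwa [e.extend_source]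
    refine ⟨e.extend (𝓡∂ (n + 1)) p, ⟨(e.extend (𝓡∂ (n + 1))).map_source hp0, ?_⟩,
      (e.extend (𝓡∂ (n + 1))).left_inv hp0⟩
    rwa [mem_preimage, (e.extend (𝓡∂ (n + 1))).left_inv hp0]

/-- Whether a point is interior can be read off in any chart of the atlas, not only in the preferred
one. This description shows that the set is open in the full Euclidean space. -/
theorem interiorTarget_eq [IsManifold (𝓡∂ (n + 1)) ∞ X] {e : OpenPartialHomeomorph X (EuclideanHalfSpace (n + 1))}
    (he : e ∈ atlas (EuclideanHalfSpace (n + 1)) X) :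
    interiorTarget e = interior (range (𝓡∂ (n + 1))) ∩ (𝓡∂ (n + 1)).symm ⁻¹' e.target := by
  have key : ∀ z ∈ (e.extend (𝓡∂ (n + 1))).target,
      ((e.extend (𝓡∂ (n + 1))).symm z ∈ (𝓡∂ (n + 1)).interior X ↔
        z ∈ interior (range (𝓡∂ (n + 1)))) := by
    intro z hz
    have hs : (e.extend (𝓡∂ (n + 1))).symm z ∈ e.source := by
      simpa only [e.extend_source] using (e.extend (𝓡∂ (n + 1))).map_target hz
    have := (𝓡∂ (n + 1)).isInteriorPoint_iff_of_mem_atlas (n := ∞) (by simp) he hs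
    rw [(e.extend (𝓡∂ (n + 1))).right_inv hz] at this
    refine this.trans ⟨fun h => interior_mono ?_ h, fun h => ?_⟩
    · rw [OpenPartialHomeomorph.extend_target]; exact inter_subset_right
    · rw [OpenPartialHomeomorph.extend_target, interior_inter]
      rw [OpenPartialHomeomorph.extend_target] at hz
      refine ⟨?_, h⟩
      rw [((e.open_target.preimage (𝓡∂ (n + 1)).continuous_symm)).interior_eq]
      exact hz.1
  ext z
  constructor
  · rintro ⟨hz, hz'⟩
    refine ⟨(key z hz).1 hz', ?_⟩
    rw [OpenPartialHomeomorph.extend_target] at hz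
    exact hz.1
  · rintro ⟨hz, hz'⟩
    have : z ∈ (e.extend (𝓡∂ (n + 1))).target := by
      rw [OpenPartialHomeomorph.extend_target]
      exact ⟨hz', interior_subset hz⟩
    exact ⟨this, (key z this).2 hz⟩

theorem isInteriorParam_extend_symm [IsManifold (𝓡∂ (n + 1)) ∞ X] {e : OpenPartialHomeomorph X (EuclideanHalfSpace (n + 1))}
    (he : e ∈ atlas (EuclideanHalfSpace (n + 1)) X) :
    IsInteriorParam (e.extend (𝓡∂ (n + 1))).symm (e.extend (𝓡∂ (n + 1))) (interiorTarget e) where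
  isOpen := by
    rw [interiorTarget_eq he]
    exact isOpen_interior.inter (e.open_target.preimage (𝓡∂ (n + 1)).continuous_symm)
  isOpen_image := by
    rw [image_interiorTarget]
    exact e.open_source.inter ((𝓡∂ (n + 1)).isOpen_interior (n := ∞) (by simp))
  smooth := (contMDiffOn_extend_symm
    (IsManifold.subset_maximalAtlas he)).mono fun z hz => by
      have := hz.1
      rwa [e.extend_target'] at this
  smooth_inv := by
    rw [image_interiorTarget]
    exact (OpenPartialHomeomorph.contMDiffOn_extend
      (IsManifold.subset_maximalAtlas he)).mono inter_subset_left
  leftInv z hz := (e.extend (𝓡∂ (n + 1))).right_inv hz.1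
  mapsTo _ hz := hz.2

/-- At interior coordinates the range of the model is a neighbourhood, so the derivative within it
is the ordinary derivative. -/
theorem gram_eq_paramGram [IsManifold (𝓡∂ (n + 1)) ∞ X] (g : FormField n X)
    {e : OpenPartialHomeomorph X (EuclideanHalfSpace (n + 1))}
    (he : e ∈ atlas (EuclideanHalfSpace (n + 1)) X) {z : 𝔼[n]} (hz : z ∈ interiorTarget e) :
    gram g e z = paramGram g (e.extend (𝓡∂ (n + 1))).symm z := by
  have h1 : range (𝓡∂ (n + 1)) ∈ 𝓝 z := by
    rw [interiorTarget_eq he] at hz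
    exact mem_interior_iff_mem_nhds.1 hz.1
  simp only [gram, paramGram, coordVec, mfderivWithin_of_mem_nhds h1]

/-! ### The Riemannian volume in a parametrization -/

/-- The measure `|det (g_ij)|^{1/2} dz` on `Ω`, transported by `φ`. -/
noncomputable def paramVolume [MeasurableSpace X] (g : FormField n X) (φ : 𝔼[n] → X)
    (Ω : Set 𝔼[n]) : Measure X :=
  (((volume : Measure 𝔼[n]).restrict Ω).withDensity
    fun z => ENNReal.ofReal (Real.sqrt (paramGram g φ z).det)).map φ

section Volume

variable [MeasurableSpace X] {g : FormField n X}
  {φ φ₁ φ₂ : 𝔼[n] → X} {ψ ψ₁ ψ₂ : X → 𝔼[n]} {Ω Ω₁ Ω₂ : Set 𝔼[n]}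

theorem chartVolume_eq_paramVolume [IsManifold (𝓡∂ (n + 1)) ∞ X] (g : FormField n X)
    {e : OpenPartialHomeomorph X (EuclideanHalfSpace (n + 1))}
    (he : e ∈ atlas (EuclideanHalfSpace (n + 1)) X) :
    chartVolume g e = paramVolume g (e.extend (𝓡∂ (n + 1))).symm (interiorTarget e) := by
  have h1 := isInteriorParam_extend_symm he
  rw [chartVolume, paramVolume]
  change (Measure.withDensity (volume.restrict (interiorTarget e)) _).map _ = _
  congr 1
  refine withDensity_congr_ae ?_
  filter_upwards [ae_restrict_mem h1.isOpen.measurableSet] with z hz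
  rw [gram_eq_paramGram g he hz]

variable [BorelSpace X]

namespace IsInteriorParam

theorem aemeasurable (h : IsInteriorParam φ ψ Ω) (f : 𝔼[n] → ENNReal) :
    AEMeasurable φ ((volume.restrict Ω).withDensity f) :=
  (h.smooth.continuousOn.aemeasurable h.isOpen.measurableSet).mono_ac
    (withDensity_absolutelyContinuous _ _)

theorem paramVolume_apply (h : IsInteriorParam φ ψ Ω) {S : Set X} (hS : MeasurableSet S) :
    paramVolume g φ Ω S =
      ∫⁻ z in Ω ∩ φ ⁻¹' S, ENNReal.ofReal (Real.sqrt (paramGram g φ z).det) := by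
  rw [paramVolume, Measure.map_apply_of_aemeasurable (h.aemeasurable _) hS, withDensity_apply₀,
    Measure.restrict_restrict₀, inter_comm]
  · exact ((h.smooth.continuousOn.aemeasurable h.isOpen.measurableSet).nullMeasurableSet_preimage
      hS)
  · exact ((h.smooth.continuousOn.aemeasurable h.isOpen.measurableSet).nullMeasurableSet_preimage
      hS)

theorem measurableSet_inter_preimage (h : IsInteriorParam φ ψ Ω) {S : Set X}
    (hS : MeasurableSet S) : MeasurableSet (Ω ∩ φ ⁻¹' S) := by
  have h1 : Measurable (Ω.domRestrict φ) := h.smooth.continuousOn.domRestrict.measurable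
  have h2 := h.isOpen.measurableSet.subtype_image (h1 hS)
  rwa [show Ω ∩ φ ⁻¹' S = Subtype.val '' (Ω.domRestrict φ ⁻¹' S) by
    rw [domRestrict_eq, preimage_comp, Subtype.image_preimage_coe]]

/-- Change of variables on the overlap: two coordinate densities define the same measure where both
parametrizations are available. -/
theorem paramVolume_restrict_image [IsManifold (𝓡∂ (n + 1)) ∞ X] (h₁ : IsInteriorParam φ₁ ψ₁ Ω₁) (h₂ : IsInteriorParam φ₂ ψ₂ Ω₂)
    (hg : IsInteriorMetric g) :
    (paramVolume g φ₁ Ω₁).restrict (φ₂ '' Ω₂) = (paramVolume g φ₂ Ω₂).restrict (φ₁ '' Ω₁) := by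
  have hp := h₁.isPullbackMetric h₂ hg
  ext S hS
  have m1 := hS.inter h₁.isOpen_image.measurableSet
  have m2 := hS.inter h₂.isOpen_image.measurableSet
  rw [Measure.restrict_apply hS, Measure.restrict_apply hS, h₁.paramVolume_apply m2,
    h₂.paramVolume_apply m1]
  have hsub : Ω₁ ∩ φ₁ ⁻¹' (S ∩ φ₂ '' Ω₂) ⊆ Ω₁ ∩ φ₁ ⁻¹' (φ₂ '' Ω₂) := fun z hz => ⟨hz.1, hz.2.2⟩
  rw [hp.setLIntegral_comp hsub (h₁.measurableSet_inter_preimage m2)]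
  congr 2
  ext w
  constructor
  · rintro ⟨z, hz, rfl⟩
    have hm := hp.diffeo.mapsTo (hsub hz)
    refine ⟨hm.1, ?_, hm.2⟩
    simp only [Function.comp, h₂.comp_transition hz.2.2]
    exact hz.2.1
  · rintro ⟨hw, hwS, hw1⟩
    have hw' : w ∈ Ω₂ ∩ φ₂ ⁻¹' (φ₁ '' Ω₁) := ⟨hw, hw1⟩
    have hm := hp.diffeo.mapsTo_inv hw'
    refine ⟨(ψ₁ ∘ φ₂) w, ⟨hm.1, ?_, hm.2⟩, hp.diffeo.rightInv hw'⟩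
    simp only [Function.comp, h₁.comp_transition hw1]
    exact hwS

theorem paramVolume_compl (h : IsInteriorParam φ ψ Ω) :
    paramVolume g φ Ω (φ '' Ω)ᶜ = 0 := by
  rw [h.paramVolume_apply h.isOpen_image.measurableSet.compl]
  have : Ω ∩ φ ⁻¹' (φ '' Ω)ᶜ = ∅ := by
    ext z
    simp only [mem_inter_iff, mem_preimage, mem_compl_iff, mem_empty_iff_false, iff_false, not_and,
      not_not]
    exact fun hz => mem_image_of_mem _ hz
  rw [this, Measure.restrict_empty, lintegral_zero_measure]

theorem paramVolume_restrict_self (h : IsInteriorParam φ ψ Ω) {A : Set X} (hA : φ '' Ω ⊆ A) :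
    (paramVolume g φ Ω).restrict A = paramVolume g φ Ω :=
  Measure.restrict_eq_self_of_ae_mem <|
    measure_mono_null (compl_subset_compl.2 hA) h.paramVolume_compl

/-- Every chart volume is dominated by the coordinate volume on the image, and one chart that
contains the image attains it; this is why the image is required to lie in a single chart domain. -/
theorem riemannianVolume_restrict [IsManifold (𝓡∂ (n + 1)) ∞ X] (h : IsInteriorParam φ ψ Ω) (hg : IsInteriorMetric g)
    {e : OpenPartialHomeomorph X (EuclideanHalfSpace (n + 1))}
    (he : e ∈ atlas (EuclideanHalfSpace (n + 1)) X) (hs : φ '' Ω ⊆ e.source) :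
    (riemannianVolume g).restrict (φ '' Ω) = paramVolume g φ Ω := by
  have hA := h.isOpen_image.measurableSet
  have hle : ∀ e' ∈ atlas (EuclideanHalfSpace (n + 1)) X,
      (chartVolume g e').restrict (φ '' Ω) ≤ paramVolume g φ Ω := by
    intro e' he'
    rw [chartVolume_eq_paramVolume g he',
      (isInteriorParam_extend_symm he').paramVolume_restrict_image h hg]
    exact Measure.restrict_le_self
  apply le_antisymm
  -- Adding the measure $\top$ off the image gives an upper bound of all chart volumes at once, so
  -- the supremum can be bounded before restricting.
  · have hall : riemannianVolume g ≤ paramVolume g φ Ω + (⊤ : Measure X).restrict (φ '' Ω)ᶜ := by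
      refine iSup₂_le fun e' he' => ?_
      rw [← Measure.restrict_add_restrict_compl (μ := chartVolume g e') hA]
      exact add_le_add (hle e' he') (Measure.restrict_mono subset_rfl le_top)
    refine (Measure.restrict_mono subset_rfl hall).trans ?_
    rw [Measure.restrict_add, Measure.restrict_restrict hA, inter_compl_self,
      Measure.restrict_empty, add_zero]
    exact Measure.restrict_le_self
  · have h1 : chartVolume g e ≤ riemannianVolume g :=
      le_iSup₂ (f := fun e' (_ : e' ∈ atlas (EuclideanHalfSpace (n + 1)) X) => chartVolume g e')
        e he
    refine le_trans (le_of_eq ?_) (Measure.restrict_mono subset_rfl h1)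
    rw [chartVolume_eq_paramVolume g he,
      (isInteriorParam_extend_symm he).paramVolume_restrict_image h hg, h.paramVolume_restrict_self]
    rw [image_interiorTarget]
    exact subset_inter hs (image_subset_iff.2 h.mapsTo)

end IsInteriorParam

end Volume

/-! ### The Laplacian and the gradient in a parametrization -/

theorem coordLaplacian_congr {G G' : 𝔼[n] → Matrix (Fin (n + 1)) (Fin (n + 1)) ℝ}
    {u u' : 𝔼[n] → ℝ} {z : 𝔼[n]} (hG : G =ᶠ[𝓝 z] G') (hu : u =ᶠ[𝓝 z] u') :
    coordLaplacian G u z = coordLaplacian G' u' z := by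
  have h1 : ∀ j, gradFlux G u j =ᶠ[𝓝 z] gradFlux G' u' j := by
    intro j
    filter_upwards [hG, hu.fderiv (𝕜 := ℝ)] with y hy hy'
    simp only [gradFlux, hy, hy']
  rw [coordLaplacian_eq, coordLaplacian_eq, hG.eq_of_nhds]
  simp only [fun j => (h1 j).fderiv_eq (𝕜 := ℝ)]

theorem coordGradPairing_congr {G G' : 𝔼[n] → Matrix (Fin (n + 1)) (Fin (n + 1)) ℝ}
    {u u' w w' : 𝔼[n] → ℝ} {z : 𝔼[n]} (hG : G z = G' z) (hu : u =ᶠ[𝓝 z] u')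
    (hw : w =ᶠ[𝓝 z] w') : coordGradPairing G u w z = coordGradPairing G' u' w' z := by
  simp only [coordGradPairing, hG, hu.fderiv_eq, hw.fderiv_eq]

namespace IsInteriorParam

variable {g : FormField n X} {φ : 𝔼[n] → X} {ψ : X → 𝔼[n]} {Ω : Set 𝔼[n]}

theorem contDiffOn_comp (h : IsInteriorParam φ ψ Ω) {u : X → ℝ}
    (hu : ContMDiffOn (𝓡∂ (n + 1)) 𝓘(ℝ, ℝ) ∞ u (φ '' Ω)) : ContDiffOn ℝ ∞ (u ∘ φ) Ω :=
  contMDiffOn_iff_contDiffOn.1 (hu.comp h.smooth fun _ hz => mem_image_of_mem _ hz)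

theorem mem_overlap_chartAt (h : IsInteriorParam φ ψ Ω) {z : 𝔼[n]} (hz : z ∈ Ω) :
    extChartAt (𝓡∂ (n + 1)) (φ z) (φ z) ∈ interiorTarget (chartAt _ (φ z)) ∩
      (extChartAt (𝓡∂ (n + 1)) (φ z)).symm ⁻¹' (φ '' Ω) := by
  refine ⟨⟨mem_extChartAt_target _, ?_⟩, ?_⟩
  · exact (congrArg (· ∈ (𝓡∂ (n + 1)).interior X) (extChartAt_to_inv (φ z))).mpr (h.mapsTo hz)
  · rw [mem_preimage, extChartAt_to_inv]
    exact mem_image_of_mem _ hz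

/-- The chart used by `laplacian` changes with the point; invariance under the transition from that
chart to $\varphi$ gives one formula on all of $\Omega$. -/
theorem laplacian_eq [IsManifold (𝓡∂ (n + 1)) ∞ X] (h : IsInteriorParam φ ψ Ω) (hg : IsInteriorMetric g) {u : X → ℝ}
    (hu : ContMDiffOn (𝓡∂ (n + 1)) 𝓘(ℝ, ℝ) ∞ u (φ '' Ω)) {z : 𝔼[n]} (hz : z ∈ Ω) :
    laplacian g u (φ z) = coordLaplacian (paramGram g φ) (u ∘ φ) z := by
  have he := chart_mem_atlas (EuclideanHalfSpace (n + 1)) (φ z)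
  have hc := isInteriorParam_extend_symm he
  have hp := hc.isPullbackMetric h hg
  have hm := h.mem_overlap_chartAt hz
  have e1 := hp.coordLaplacian_comp ((h.contDiffOn_comp hu).mono inter_subset_left) hm
  have e2 : (ψ ∘ ((chartAt (EuclideanHalfSpace (n + 1)) (φ z)).extend (𝓡∂ (n + 1))).symm)
      (extChartAt (𝓡∂ (n + 1)) (φ z) (φ z)) = z :=
    (congrArg ψ (extChartAt_to_inv (φ z))).trans (h.leftInv hz)
  rw [e2] at e1
  rw [← e1, laplacian]
  refine coordLaplacian_congr ?_ ?_
  · filter_upwards [hc.isOpen.mem_nhds hm.1] with y hy using gram_eq_paramGram g he hy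
  · filter_upwards [hp.diffeo.isOpen_left.mem_nhds hm] with y hy
    exact (congrArg u (h.comp_transition hy.2)).symm

theorem gradPairing_eq [IsManifold (𝓡∂ (n + 1)) ∞ X] (h : IsInteriorParam φ ψ Ω) (hg : IsInteriorMetric g) {u w : X → ℝ}
    (hu : ContMDiffOn (𝓡∂ (n + 1)) 𝓘(ℝ, ℝ) ∞ u (φ '' Ω))
    (hw : ContMDiffOn (𝓡∂ (n + 1)) 𝓘(ℝ, ℝ) ∞ w (φ '' Ω)) {z : 𝔼[n]} (hz : z ∈ Ω) :
    gradPairing g u w (φ z) = coordGradPairing (paramGram g φ) (u ∘ φ) (w ∘ φ) z := by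
  have he := chart_mem_atlas (EuclideanHalfSpace (n + 1)) (φ z)
  have hc := isInteriorParam_extend_symm he
  have hp := hc.isPullbackMetric h hg
  have hm := h.mem_overlap_chartAt hz
  have e2 : (ψ ∘ ((chartAt (EuclideanHalfSpace (n + 1)) (φ z)).extend (𝓡∂ (n + 1))).symm)
      (extChartAt (𝓡∂ (n + 1)) (φ z) (φ z)) = z :=
    (congrArg ψ (extChartAt_to_inv (φ z))).trans (h.leftInv hz)
  have hd : ∀ {f : X → ℝ}, ContMDiffOn (𝓡∂ (n + 1)) 𝓘(ℝ, ℝ) ∞ f (φ '' Ω) →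
      DifferentiableAt ℝ (f ∘ φ) z := fun hf =>
    ((h.contDiffOn_comp hf).contDiffAt (h.isOpen.mem_nhds hz)).differentiableAt (by simp)
  have e1 := hp.coordGradPairing_comp hm (by rw [e2]; exact hd hu) (by rw [e2]; exact hd hw)
  rw [e2] at e1
  rw [← e1, gradPairing]
  have e3 : ∀ f : X → ℝ, f ∘ (extChartAt (𝓡∂ (n + 1)) (φ z)).symm
      =ᶠ[𝓝 (extChartAt (𝓡∂ (n + 1)) (φ z) (φ z))]
      (f ∘ φ) ∘ (ψ ∘ ((chartAt (EuclideanHalfSpace (n + 1)) (φ z)).extend (𝓡∂ (n + 1))).symm) := by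
    intro f
    filter_upwards [hp.diffeo.isOpen_left.mem_nhds hm] with y hy
    exact (congrArg f (h.comp_transition hy.2)).symm
  exact coordGradPairing_congr (gram_eq_paramGram g he hm.1) (e3 u) (e3 w)

end IsInteriorParam

end

section

/-! ### The quadratic form of `P` in a parametrization -/

/-- Stated through differentials so as to absorb the product rule, both for $b\sqrt F$ and for the
lapse. -/
theorem coordGradPairing_eq_combination {G : 𝔼[n] → Matrix (Fin (n + 1)) (Fin (n + 1)) ℝ}
    {u u₁ u₂ w : 𝔼[n] → ℝ} {z : 𝔼[n]} {a c : ℝ}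
    (h : fderiv ℝ u z = a • fderiv ℝ u₁ z + c • fderiv ℝ u₂ z) :
    coordGradPairing G u w z = a * coordGradPairing G u₁ w z + c * coordGradPairing G u₂ w z := by
  simp only [coordGradPairing, h, add_apply, smul_apply, smul_eq_mul, Finset.mul_sum,
    ← Finset.sum_add_distrib]
  exact Finset.sum_congr rfl fun i _ => Finset.sum_congr rfl fun j _ => by ring

theorem contDiff_mul_of_tsupport_subset {b F : 𝔼[n] → ℝ} {U : Set 𝔼[n]} (hU : IsOpen U)
    (hb : ContDiff ℝ ∞ b) (hbU : tsupport b ⊆ U) (hF : ContDiffOn ℝ ∞ F U) :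
    ContDiff ℝ ∞ fun z => b z * F z := by
  refine contMDiff_iff_contDiff.1 (contMDiff_of_tsupport fun z hz => ?_)
  have hz' : z ∈ U := hbU (tsupport_mul_subset_left hz)
  exact (hb.contDiffAt.mul (hF.contDiffAt (hU.mem_nhds hz'))).contMDiffAt

/-- Here $F^{-1/2}F=F^{1/2}$, and Green's formula with test function $bF^{1/2}$ produces
$F^{1/2}|\nabla b|^2+\frac12 bF^{-1/2}\langle\nabla F,\nabla b\rangle$. The second term cancels the
first-order term of the operator, which is why that term and the weight are matched. -/
theorem IsMetricOn.integral_energy {G : 𝔼[n] → Matrix (Fin (n + 1)) (Fin (n + 1)) ℝ}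
    {U : Set 𝔼[n]} (hG : IsMetricOn G U) (hU : IsOpen U) {b F W : 𝔼[n] → ℝ}
    (hb : ContDiff ℝ ∞ b) (hbc : HasCompactSupport b) (hbU : tsupport b ⊆ U)
    (hF : ContDiffOn ℝ ∞ F U) (hF0 : ∀ z ∈ U, 0 < F z) (hW : ContinuousOn W U) :
    ∫ z in U, Real.sqrt (G z).det * ((Real.sqrt (F z))⁻¹ * (b z * (F z * coordLaplacian G b z -
      1 / 2 * coordGradPairing G F b z + W z * b z))) =
    ∫ z in U, Real.sqrt (G z).det * (Real.sqrt (F z) * coordGradPairing G b b z +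
      (Real.sqrt (F z))⁻¹ * W z * b z ^ 2) := by
  have hs : ContDiffOn ℝ ∞ (fun z => Real.sqrt (F z)) U := hF.sqrt fun z hz => (hF0 z hz).ne'
  have hs0 : ∀ z ∈ U, Real.sqrt (F z) ≠ 0 := fun z hz => (Real.sqrt_pos.2 (hF0 z hz)).ne'
  set f : 𝔼[n] → ℝ := fun z => b z * Real.sqrt (F z) with hf
  have hfs : ContDiff ℝ ∞ f := contDiff_mul_of_tsupport_subset hU hb hbU hs
  have hfU : tsupport f ⊆ U := (tsupport_mul_subset_left).trans hbU
  have key := hG.integral_mul_coordLaplacian hU hfs hbc.mul_right hfU hb.contDiffOn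
  have c0 := hG.contDiffOn_sqrt_det.continuousOn
  have cL : ContinuousOn (coordLaplacian G b) U :=
    (hG.contDiffOn_coordLaplacian hU hb.contDiffOn).continuousOn
  have cF : ContinuousOn (coordGradPairing G F b) U :=
    (hG.contDiffOn_coordGradPairing hU hF hb.contDiffOn).continuousOn
  have cs := hs.continuousOn
  have csi : ContinuousOn (fun z => (Real.sqrt (F z))⁻¹) U := cs.inv₀ hs0
  have hpair : ∀ z ∈ U, coordGradPairing G f b z =
      Real.sqrt (F z) * coordGradPairing G b b z +
        b z * (Real.sqrt (F z))⁻¹ / 2 * coordGradPairing G F b z := by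
    intro z hz
    refine coordGradPairing_eq_combination ?_
    have hFd := ((hF.contDiffAt (hU.mem_nhds hz)).differentiableAt (by simp)).hasFDerivAt
    have hbd := (hb.differentiable (by simp) z).hasFDerivAt
    have hsd := hFd.sqrt (hF0 z hz).ne'
    have h1 : fderiv ℝ f z = _ := (hbd.mul hsd).fderiv
    rw [h1]
    ext y
    have := hs0 z hz
    simp only [add_apply, smul_apply, smul_eq_mul]
    field_simp
    ring
  -- The terms not touched by the integration by parts; the gradient part of `r` cancels the second
  -- term of `hpair`.
  set r : 𝔼[n] → ℝ := fun z => Real.sqrt (G z).det * (b z * (Real.sqrt (F z))⁻¹ *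
    (W z * b z - 1 / 2 * coordGradPairing G F b z)) with hr
  have i1 : IntegrableOn (fun z => Real.sqrt (G z).det * (f z * coordLaplacian G b z)) U := by
    refine (integrable_mul_of_tsupport_subset hU hfs.continuous hbc.mul_right hfU
      (c0.mul cL)).integrableOn.congr_fun (fun z _ => ?_) hU.measurableSet
    simp only [Pi.mul_apply]
    ring
  have i2 : IntegrableOn (fun z => Real.sqrt (G z).det * coordGradPairing G f b z) U := by
    have : ∀ z, Real.sqrt (G z).det * coordGradPairing G f b z =
        ∑ j, fderiv ℝ f z (EuclideanSpace.single j (1 : ℝ)) * gradFlux G b j z :=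
      sqrt_det_mul_coordGradPairing G f b
    simp only [this]
    refine integrable_finsetSum _ fun j _ => (integrable_mul_of_tsupport_subset hU
      (hfs.continuous_fderiv_apply (by simp) |>.comp (continuous_id.prodMk continuous_const))
      ((hbc.mul_right : HasCompactSupport f).fderiv_apply ℝ _)
      ((tsupport_fderiv_apply_subset ℝ _).trans hfU)
      (hG.contDiffOn_gradFlux hU hb.contDiffOn j).continuousOn).integrableOn
  have i3 : IntegrableOn r U := by
    refine (integrable_mul_of_tsupport_subset hU hb.continuous hbc hbU
      (c0.mul (csi.mul ((hW.mul hb.continuous.continuousOn).sub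
        (cF.const_smul (1 / 2 : ℝ)))))).integrableOn.congr_fun (fun z _ => ?_) hU.measurableSet
    simp only [Pi.mul_apply, Pi.sub_apply, Pi.smul_apply, smul_eq_mul, hr]
    ring
  have e1 : ∫ z in U, Real.sqrt (G z).det * ((Real.sqrt (F z))⁻¹ * (b z *
      (F z * coordLaplacian G b z - 1 / 2 * coordGradPairing G F b z + W z * b z))) =
      ∫ z in U, (Real.sqrt (G z).det * (f z * coordLaplacian G b z) + r z) := by
    refine setIntegral_congr_fun hU.measurableSet fun z hz => ?_
    have h1 := hs0 z hz
    have h2 := Real.mul_self_sqrt (hF0 z hz).le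
    simp only [hf, hr]
    -- With $F=q^2$ the identity becomes rational in $q$.
    generalize Real.sqrt (F z) = q at h1 h2 ⊢
    rw [← h2]
    field_simp
    ring
  rw [e1, integral_add i1 i3, key, ← integral_add i2 i3]
  refine setIntegral_congr_fun hU.measurableSet fun z hz => ?_
  simp only [hr, hpair z hz]
  ring

variable {X : Type*} [TopologicalSpace X] [ChartedSpace (EuclideanHalfSpace (n + 1)) X]

theorem rpow_neg_half {t : ℝ} (ht : 0 ≤ t) : t ^ (-(1 / 2 : ℝ)) = (Real.sqrt t)⁻¹ := by
  rw [Real.rpow_neg ht, Real.sqrt_eq_rpow]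

namespace IsInteriorParam

variable {g : FormField n X} {φ : 𝔼[n] → X} {ψ : X → 𝔼[n]} {Ω : Set 𝔼[n]}

/-- Integrals against a measure with density with respect to the Riemannian volume, for
integrands given by `K` in the coordinates. -/
theorem setIntegral_withDensity_riemannianVolume [IsManifold (𝓡∂ (n + 1)) ∞ X]
    [MeasurableSpace X] [BorelSpace X] (h : IsInteriorParam φ ψ Ω) (hg : IsInteriorMetric g)
    {e : OpenPartialHomeomorph X (EuclideanHalfSpace (n + 1))}
    (he : e ∈ atlas (EuclideanHalfSpace (n + 1)) X) (hs : φ '' Ω ⊆ e.source)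
    {D K : X → ℝ} {D' K' : 𝔼[n] → ℝ} (hD : ∀ z ∈ Ω, D (φ z) = D' z) (hD0 : ∀ z ∈ Ω, 0 ≤ D' z)
    (hK : ∀ z ∈ Ω, K (φ z) = K' z) (hD' : ContinuousOn D' Ω) (hK' : ContinuousOn K' Ω) :
    ∫ p in φ '' Ω, K p ∂((riemannianVolume g).withDensity fun p => ENNReal.ofReal (D p)) =
      ∫ z in Ω, Real.sqrt (paramGram g φ z).det * (D' z * K' z) := by
  have hA := h.isOpen_image.measurableSet
  have hψ := h.smooth_inv.continuousOn
  have hψm : MapsTo ψ (φ '' Ω) Ω := by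
    rintro _ ⟨z, hz, rfl⟩
    rwa [h.leftInv hz]
  -- The coordinate measure lives on the image, so measurability of $D$ and $K$ is needed only
  -- there, where both are continuous in coordinates.
  have hself := h.paramVolume_restrict_self (g := g) subset_rfl
  have mD : AEMeasurable D (paramVolume g φ Ω) := by
    rw [← hself]
    refine ((hD'.comp hψ hψm).aemeasurable hA).congr ?_
    filter_upwards [ae_restrict_mem hA] with p hp
    obtain ⟨z, hz, rfl⟩ := hp
    simp only [Function.comp, h.leftInv hz, hD z hz]
  have mK : AEStronglyMeasurable K (paramVolume g φ Ω) := by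
    rw [← hself]
    refine ((hK'.comp hψ hψm).aestronglyMeasurable hA).congr ?_
    filter_upwards [ae_restrict_mem hA] with p hp
    obtain ⟨z, hz, rfl⟩ := hp
    simp only [Function.comp, h.leftInv hz, hK z hz]
  have hsqrt : AEMeasurable (fun z => ENNReal.ofReal (Real.sqrt (paramGram g φ z).det))
      (volume.restrict Ω) :=
    ((h.isMetricOn hg).contDiffOn_sqrt_det.continuousOn.aemeasurable
      h.isOpen.measurableSet).ennreal_ofReal
  rw [restrict_withDensity hA, h.riemannianVolume_restrict hg he hs,
    integral_withDensity_eq_integral_toReal_smul₀ mD.ennreal_ofReal (by simp)]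
  rw [paramVolume] at mD mK ⊢
  have hm : AEStronglyMeasurable (fun p => (ENNReal.ofReal (D p)).toReal • K p) _ :=
    mD.ennreal_ofReal.ennreal_toReal.aestronglyMeasurable.smul mK
  rw [integral_map (h.aemeasurable _) hm,
    integral_withDensity_eq_integral_toReal_smul₀ hsqrt (by simp)]
  refine setIntegral_congr_fun h.isOpen.measurableSet fun z hz => ?_
  simp only [smul_eq_mul, hD z hz, hK z hz, ENNReal.toReal_ofReal (hD0 z hz),
    ENNReal.toReal_ofReal (Real.sqrt_nonneg _)]

theorem contDiffOn_lapse (h : IsInteriorParam φ ψ Ω) {x beth : X → ℝ} (δ aleph : ℝ)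
    (hx : ContMDiffOn (𝓡∂ (n + 1)) 𝓘(ℝ, ℝ) ∞ x (φ '' Ω)) (hx0 : ∀ p ∈ φ '' Ω, 0 < x p)
    (hbeth : ContMDiffOn (𝓡∂ (n + 1)) 𝓘(ℝ, ℝ) ∞ beth (φ '' Ω)) :
    ContDiffOn ℝ ∞ (fun z => lapse x δ aleph beth (φ z)) Ω := by
  have xs : ContDiffOn ℝ ∞ (fun z => x (φ z)) Ω := h.contDiffOn_comp hx
  have bs : ContDiffOn ℝ ∞ (fun z => beth (φ z)) Ω := h.contDiffOn_comp hbeth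
  exact (contDiffOn_const.add (xs.mul contDiffOn_const)).add
    ((xs.rpow_const_of_ne fun z hz => (hx0 _ (mem_image_of_mem φ hz)).ne').mul bs)

theorem contDiffOn_effPotential (h : IsInteriorParam φ ψ Ω) {x beth V : X → ℝ} (δ aleph m : ℝ)
    (hx : ContMDiffOn (𝓡∂ (n + 1)) 𝓘(ℝ, ℝ) ∞ x (φ '' Ω)) (hx0 : ∀ p ∈ φ '' Ω, 0 < x p)
    (hbeth : ContMDiffOn (𝓡∂ (n + 1)) 𝓘(ℝ, ℝ) ∞ beth (φ '' Ω))
    (hV : ContMDiffOn (𝓡∂ (n + 1)) 𝓘(ℝ, ℝ) ∞ V (φ '' Ω)) :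
    ContDiffOn ℝ ∞ (fun z => effPotential x δ aleph m beth V (φ z)) Ω := by
  have xs : ContDiffOn ℝ ∞ (fun z => x (φ z)) Ω := h.contDiffOn_comp hx
  have bs : ContDiffOn ℝ ∞ (fun z => beth (φ z)) Ω := h.contDiffOn_comp hbeth
  have vs : ContDiffOn ℝ ∞ (fun z => V (φ z)) Ω := h.contDiffOn_comp hV
  exact (((xs.mul contDiffOn_const).mul contDiffOn_const).add
    (((xs.rpow_const_of_ne fun z hz => (hx0 _ (mem_image_of_mem φ hz)).ne').mul
      contDiffOn_const).mul bs)).add ((h.contDiffOn_lapse δ aleph hx hx0 hbeth).mul vs)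

/-- In coordinates $P$ is $F\triangle-\frac12\langle\nabla F,\nabla\,\cdot\,\rangle+W$ with $F$ the
lapse, so `IsMetricOn.integral_energy` applies. -/
theorem innerL2_opP_eq [T2Space X] [IsManifold (𝓡∂ (n + 1)) ∞ X] [MeasurableSpace X] [BorelSpace X]
    (h : IsInteriorParam φ ψ Ω) (hg : IsInteriorMetric g)
    {e : OpenPartialHomeomorph X (EuclideanHalfSpace (n + 1))}
    (he : e ∈ atlas (EuclideanHalfSpace (n + 1)) X) (hs : φ '' Ω ⊆ e.source)
    {x beth V : X → ℝ} {δ aleph m : ℝ}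
    (hx : ContMDiffOn (𝓡∂ (n + 1)) 𝓘(ℝ, ℝ) ∞ x (φ '' Ω)) (hx0 : ∀ p ∈ φ '' Ω, 0 < x p)
    (hbeth : ContMDiffOn (𝓡∂ (n + 1)) 𝓘(ℝ, ℝ) ∞ beth (φ '' Ω))
    (hV : ContMDiffOn (𝓡∂ (n + 1)) 𝓘(ℝ, ℝ) ∞ V (φ '' Ω))
    (hlapse : ∀ p ∈ φ '' Ω, 0 < lapse x δ aleph beth p)
    {b : 𝔼[n] → ℝ} (hb : ContDiff ℝ ∞ b) (hbc : HasCompactSupport b) (hbΩ : tsupport b ⊆ Ω) :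
    innerL2 (weightedVolume g x δ aleph beth) (extendZero (φ '' Ω) ψ b)
      (opP g x δ aleph m beth V (extendZero (φ '' Ω) ψ b)) =
    ∫ z in Ω, Real.sqrt (paramGram g φ z).det *
      (Real.sqrt (lapse x δ aleph beth (φ z)) * coordGradPairing (paramGram g φ) b b z +
      (Real.sqrt (lapse x δ aleph beth (φ z)))⁻¹ * effPotential x δ aleph m beth V (φ z) *
        b z ^ 2) := by
  set v := extendZero (φ '' Ω) ψ b with hv
  set F : 𝔼[n] → ℝ := fun z => lapse x δ aleph beth (φ z) with hF
  set W : 𝔼[n] → ℝ := fun z => effPotential x δ aleph m beth V (φ z) with hW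
  have hvs : ContMDiff (𝓡∂ (n + 1)) 𝓘(ℝ, ℝ) ∞ v := contMDiff_extendZero h.leftInv
    h.smooth.continuousOn h.isOpen_image h.smooth_inv hb hbc hbΩ
  have xs : ContDiffOn ℝ ∞ (fun z => x (φ z)) Ω := h.contDiffOn_comp hx
  have bs : ContDiffOn ℝ ∞ (fun z => beth (φ z)) Ω := h.contDiffOn_comp hbeth
  have x0 : ∀ z ∈ Ω, 0 < x (φ z) := fun z hz => hx0 _ (mem_image_of_mem _ hz)
  have Fs : ContDiffOn ℝ ∞ F Ω := h.contDiffOn_lapse δ aleph hx hx0 hbeth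
  have F0 : ∀ z ∈ Ω, 0 < F z := fun z hz => hlapse _ (mem_image_of_mem _ hz)
  have Ws : ContDiffOn ℝ ∞ W Ω := h.contDiffOn_effPotential δ aleph m hx hx0 hbeth hV
  have hG := h.isMetricOn hg
  have vb : ∀ z ∈ Ω, v (φ z) = b z := fun z hz => by
    rw [hv, extendZero_apply_of_mem (mem_image_of_mem _ hz), h.leftInv hz]
  have hP : ∀ z ∈ Ω, opP g x δ aleph m beth V v (φ z) =
      F z * coordLaplacian (paramGram g φ) b z - 1 / 2 * coordGradPairing (paramGram g φ) F b z +
        W z * b z := by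
    intro z hz
    have hvb : v ∘ φ =ᶠ[𝓝 z] b := by
      filter_upwards [h.isOpen.mem_nhds hz] with y hy using vb y hy
    have hxd := ((xs.contDiffAt (h.isOpen.mem_nhds hz)).differentiableAt (by simp)).hasFDerivAt
    have hbd := ((bs.contDiffAt (h.isOpen.mem_nhds hz)).differentiableAt (by simp)).hasFDerivAt
    -- The explicit first-order coefficients of $P$ are those of $\nabla f$: here
    -- $f=1+x\aleph+x^{1+\delta}\beth$ is differentiated by the product rule.
    have hgrad : coordGradPairing (paramGram g φ) F b z =
        x (φ z) ^ (1 + δ) * coordGradPairing (paramGram g φ) (beth ∘ φ) b z +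
        (aleph + (1 + δ) * x (φ z) ^ δ * beth (φ z)) *
          coordGradPairing (paramGram g φ) (x ∘ φ) b z := by
      refine coordGradPairing_eq_combination ?_
      have h1 := ((hxd.mul_const aleph).const_add 1).add
        ((hxd.rpow_const (p := 1 + δ) (Or.inl (x0 z hz).ne')).mul hbd)
      have h2 : fderiv ℝ F z = _ := h1.fderiv
      rw [h2, add_sub_cancel_left]
      ext y
      simp only [add_apply, smul_apply, smul_eq_mul, Function.comp_def]
      ring
    rw [opP, h.laplacian_eq hg hvs.contMDiffOn hz, h.gradPairing_eq hg hbeth hvs.contMDiffOn hz,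
      h.gradPairing_eq hg hx hvs.contMDiffOn hz, vb z hz,
      coordLaplacian_congr Filter.EventuallyEq.rfl hvb,
      coordGradPairing_congr rfl Filter.EventuallyEq.rfl hvb,
      coordGradPairing_congr (u := x ∘ φ) rfl Filter.EventuallyEq.rfl hvb, hgrad]
  have cP : ContinuousOn (fun z => b z * (F z * coordLaplacian (paramGram g φ) b z -
      1 / 2 * coordGradPairing (paramGram g φ) F b z + W z * b z)) Ω :=
    hb.continuous.continuousOn.mul (((Fs.continuousOn.mul
      (hG.contDiffOn_coordLaplacian h.isOpen hb.contDiffOn).continuousOn).sub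
      (continuousOn_const.mul
        (hG.contDiffOn_coordGradPairing h.isOpen Fs hb.contDiffOn).continuousOn)).add
      (Ws.continuousOn.mul hb.continuous.continuousOn))
  have cF : ContinuousOn (fun z => (Real.sqrt (F z))⁻¹) Ω :=
    Fs.continuousOn.sqrt.inv₀ fun z hz => (Real.sqrt_pos.2 (F0 z hz)).ne'
  rw [innerL2, weightedVolume, ← setIntegral_eq_integral_of_forall_compl_eq_zero (s := φ '' Ω)
    (fun p hp => by rw [hv, extendZero, indicator_of_notMem hp, zero_mul]),
    h.setIntegral_withDensity_riemannianVolume hg he hs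
      (fun z hz => rpow_neg_half (F0 z hz).le) (fun z _ => inv_nonneg.2 (Real.sqrt_nonneg _))
      (fun z hz => by rw [vb z hz, hP z hz]) cF cP]
  exact hG.integral_energy h.isOpen hb hbc hbΩ Fs F0 Ws.continuousOn

end IsInteriorParam

end

section

/-! ### Rescaled collar coordinates -/

/-- The splitting of `ℝ^{n+1}` into the first coordinate and the others. -/
noncomputable def headTail (n : ℕ) : 𝔼[n] ≃L[ℝ] ℝ × EuclideanSpace ℝ (Fin n) :=
  LinearEquiv.toContinuousLinearEquiv
    { toFun := fun z => (z 0, WithLp.toLp 2 fun i => z i.succ)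
      invFun := fun q => WithLp.toLp 2 (Fin.cons q.1 q.2.ofLp)
      map_add' := fun _ _ => rfl
      map_smul' := fun _ _ => rfl
      left_inv := fun z => by
        ext i
        refine Fin.cases ?_ (fun j => ?_) i <;> simp
      right_inv := fun q => by simp }

theorem norm_sq_headTail (z : 𝔼[n]) :
    ‖z‖ ^ 2 = (headTail n z).1 ^ 2 + ‖(headTail n z).2‖ ^ 2 := by
  simp only [EuclideanSpace.norm_sq_eq, Fin.sum_univ_succ, Real.norm_eq_abs, sq_abs]
  rfl

/-- The box `(1, 2) × B(c, r)`. -/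
def unitBox (c : EuclideanSpace ℝ (Fin n)) (r : ℝ) : Set 𝔼[n] :=
  headTail n ⁻¹' (Ioo 1 2 ×ˢ Metric.ball c r)

theorem isOpen_unitBox (c : EuclideanSpace ℝ (Fin n)) (r : ℝ) : IsOpen (unitBox c r) :=
  (isOpen_Ioo.prod Metric.isOpen_ball).preimage (headTail n).continuous

variable {X : Type*} [TopologicalSpace X] [ChartedSpace (EuclideanHalfSpace (n + 1)) X]
  {Y : Type*} [TopologicalSpace Y] [ChartedSpace (EuclideanSpace ℝ (Fin n)) Y]
  {x : X → ℝ} {xbar : ℝ}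

/-- The point of `[0, ∞) × Y` with coordinates `(ε z₀, z')`. -/
noncomputable def collarPoint (e : OpenPartialHomeomorph Y (EuclideanSpace ℝ (Fin n))) (ε : ℝ)
    (z : 𝔼[n]) : ℝ × Y :=
  (ε * (headTail n z).1, e.symm (headTail n z).2)

/-- Collar coordinates, with the boundary defining function rescaled by `ε`. -/
noncomputable def collarParam (ι : Collar n Y x xbar)
    (e : OpenPartialHomeomorph Y (EuclideanSpace ℝ (Fin n))) (ε : ℝ) (z : 𝔼[n]) : X :=
  ι.toFun (collarPoint e ε z)

/-- The inverse of `collarParam`. -/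
noncomputable def collarCoord (ι : Collar n Y x xbar)
    (e : OpenPartialHomeomorph Y (EuclideanSpace ℝ (Fin n))) (ε : ℝ) (p : X) : 𝔼[n] :=
  (headTail n).symm ((ι.invFun p).1 / ε, e (ι.invFun p).2)

section

variable {e : OpenPartialHomeomorph Y (EuclideanSpace ℝ (Fin n))} {ε r : ℝ}
  {c : EuclideanSpace ℝ (Fin n)}

theorem contMDiffOn_collarPoint [IsManifold (𝓡 n) ∞ Y]
    (he : e ∈ atlas (EuclideanSpace ℝ (Fin n)) Y)
    (hr : Metric.ball c r ⊆ e.target) :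
    ContMDiffOn 𝓘(ℝ, 𝔼[n]) (𝓘(ℝ, ℝ).prod (𝓡 n)) ∞ (collarPoint e ε) (unitBox c r) := by
  have h1 : ContDiff ℝ ∞ fun z : 𝔼[n] => ε * (headTail n z).1 :=
    contDiff_const.mul (contDiff_fst.comp (headTail n).contDiff)
  have h2 : ContDiff ℝ ∞ fun z : 𝔼[n] => (headTail n z).2 :=
    contDiff_snd.comp (headTail n).contDiff
  refine h1.contMDiff.contMDiffOn.prodMk ?_
  exact (contMDiffOn_symm_of_mem_maximalAtlas (IsManifold.subset_maximalAtlas he)).comp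
    h2.contMDiff.contMDiffOn fun z hz => hr hz.2

variable (ι : Collar n Y x xbar)

theorem collarPoint_mem {Y : Type*} [TopologicalSpace Y]
    {e : OpenPartialHomeomorph Y (EuclideanSpace ℝ (Fin n))} (hε : 0 < ε) (hε' : 2 * ε ≤ xbar) {z : 𝔼[n]} (hz : z ∈ unitBox c r) :
    (collarPoint e ε z).1 ∈ Ioo 0 xbar :=
  ⟨mul_pos hε (by linarith [hz.1.1]), by
    have : ε * (headTail n z).1 < ε * 2 := mul_lt_mul_of_pos_left hz.1.2 hε
    simp only [collarPoint]
    linarith⟩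

theorem Collar.mem_source {q : ℝ × Y} (hq : q.1 ∈ Ioo 0 xbar) : q ∈ ι.source := by
  rw [ι.source_eq]
  exact ⟨Ioo_subset_Ico_self hq, mem_univ _⟩

theorem Collar.left_inv_apply {q : ℝ × Y} (hq : q.1 ∈ Ioo 0 xbar) : ι.invFun (ι.toFun q) = q :=
  ι.left_inv (ι.mem_source hq)

theorem Collar.contMDiffAt {q : ℝ × Y} (hq : q.1 ∈ Ioo 0 xbar) :
    ContMDiffAt (𝓘(ℝ, ℝ).prod (𝓡 n)) (𝓡∂ (n + 1)) ∞ ι.toFun q := by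
  refine ι.smooth_toFun.contMDiffAt ?_
  rw [ι.source_eq]
  have : q ∈ Ioo 0 xbar ×ˢ (univ : Set Y) := ⟨hq, mem_univ _⟩
  exact Filter.mem_of_superset ((isOpen_Ioo.prod isOpen_univ).mem_nhds this)
    (prod_mono Ioo_subset_Ico_self subset_rfl)

theorem x_collarParam (hε : 0 < ε) (hε' : 2 * ε ≤ xbar) {z : 𝔼[n]} (hz : z ∈ unitBox c r) :
    x (collarParam ι e ε z) = ε * (headTail n z).1 :=
  ι.x_eq _ (Ioo_subset_Ico_self (collarPoint_mem (e := e) hε hε' hz)) _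

/-- As a preimage of an open product under the inverse collar map, the image is visibly open, and it
sits in the shell $\varepsilon<x<2\varepsilon$. -/
theorem image_collarParam (hr : Metric.ball c r ⊆ e.target) (hε : 0 < ε) (hε' : 2 * ε ≤ xbar) :
    collarParam ι e ε '' unitBox c r =
      ι.target ∩ ι.invFun ⁻¹' (Ioo ε (2 * ε) ×ˢ (e.source ∩ e ⁻¹' Metric.ball c r)) := by
  ext p
  constructor
  · rintro ⟨z, hz, rfl⟩
    have hm := collarPoint_mem (e := e) hε hε' hz
    refine ⟨ι.map_source (ι.mem_source hm), ?_⟩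
    rw [mem_preimage, collarParam, ι.left_inv_apply hm]
    refine ⟨⟨?_, ?_⟩, e.map_target (hr hz.2), ?_⟩
    · have : ε * 1 < ε * (headTail n z).1 := mul_lt_mul_of_pos_left hz.1.1 hε
      simpa only [collarPoint, mul_one] using this
    · have : ε * (headTail n z).1 < ε * 2 := mul_lt_mul_of_pos_left hz.1.2 hε
      simpa only [collarPoint, mul_comm] using this
    · simpa only [collarPoint, mem_preimage, e.right_inv (hr hz.2)] using hz.2
  · rintro ⟨hp, ⟨hs, hs'⟩, hy, hy'⟩
    refine ⟨collarCoord ι e ε p, ⟨⟨?_, ?_⟩, ?_⟩, ?_⟩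
    · simpa only [collarCoord, ContinuousLinearEquiv.apply_symm_apply] using (one_lt_div hε).2 hs
    · simpa only [collarCoord, ContinuousLinearEquiv.apply_symm_apply] using (div_lt_iff₀ hε).2 hs'
    · simpa only [collarCoord, ContinuousLinearEquiv.apply_symm_apply, mem_preimage] using hy'
    · simp only [collarParam, collarPoint, collarCoord, ContinuousLinearEquiv.apply_symm_apply,
        mul_div_cancel₀ _ hε.ne', e.left_inv hy]
      exact ι.right_inv hp

theorem isInteriorParam_collarParam [IsManifold (𝓡 n) ∞ Y] [IsManifold (𝓡∂ (n + 1)) ∞ X]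
    (hx : IsBoundaryDefining (n := n) x) (he : e ∈ atlas (EuclideanSpace ℝ (Fin n)) Y)
    (hr : Metric.ball c r ⊆ e.target) (hε : 0 < ε) (hε' : 2 * ε ≤ xbar) :
    IsInteriorParam (collarParam ι e ε) (collarCoord ι e ε) (unitBox c r) where
  isOpen := isOpen_unitBox c r
  isOpen_image := by
    rw [image_collarParam ι hr hε hε']
    exact ι.smooth_invFun.continuousOn.isOpen_inter_preimage ι.open_target
      (isOpen_Ioo.prod (e.isOpen_inter_preimage Metric.isOpen_ball))
  smooth z hz := (ι.contMDiffAt (collarPoint_mem hε hε' hz)).comp_contMDiffWithinAt z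
    (contMDiffOn_collarPoint he hr z hz)
  smooth_inv := by
    rw [image_collarParam ι hr hε hε']
    have h0 := ι.smooth_invFun.mono (inter_subset_left (s := ι.target)
      (t := ι.invFun ⁻¹' (Ioo ε (2 * ε) ×ˢ (e.source ∩ e ⁻¹' Metric.ball c r))))
    have h1 := contMDiff_fst.comp_contMDiffOn h0
    have h2 := contMDiff_snd.comp_contMDiffOn h0
    have h3 := (contMDiffOn_of_mem_maximalAtlas (I := 𝓡 n) (n := ∞)
      (IsManifold.subset_maximalAtlas he)).comp h2 fun p hp => hp.2.2.1
    have h4 : ContMDiffOn (𝓡∂ (n + 1)) 𝓘(ℝ, ℝ) ∞ (fun p => (ι.invFun p).1 / ε) _ :=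
      ((contDiff_id.div_const ε).contMDiff).comp_contMDiffOn h1
    exact ((headTail n).symm.contDiff.contMDiff).comp_contMDiffOn (h4.prodMk_space h3)
  leftInv z hz := by
    simp only [collarCoord, collarParam, ι.left_inv_apply (collarPoint_mem hε hε' hz)]
    simp only [collarPoint, mul_div_cancel_left₀ _ hε.ne', e.right_inv (hr hz.2), Prod.mk.eta,
      ContinuousLinearEquiv.symm_apply_apply]
  mapsTo z hz := by
    -- The boundary is the zero set of $x$, and $x>0$ here.
    rw [← (𝓡∂ (n + 1)).compl_boundary, mem_compl_iff, ← hx.eq_zero_iff,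
      x_collarParam ι hε hε' hz]
    exact (collarPoint_mem (e := e) hε hε' hz).1.ne'

theorem mfderiv_collarParam [IsManifold (𝓡 n) ∞ Y]
    (he : e ∈ atlas (EuclideanSpace ℝ (Fin n)) Y)
    (hr : Metric.ball c r ⊆ e.target) (hε : 0 < ε) (hε' : 2 * ε ≤ xbar) {z : 𝔼[n]}
    (hz : z ∈ unitBox c r) (w : 𝔼[n]) :
    mfderiv 𝓘(ℝ, 𝔼[n]) (𝓡∂ (n + 1)) (collarParam ι e ε) z w =
      mfderiv (𝓘(ℝ, ℝ).prod (𝓡 n)) (𝓡∂ (n + 1)) ι.toFun (collarPoint e ε z)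
        ((ε * (headTail n w).1, mfderiv (𝓡 n) (𝓡 n) e.symm (headTail n z).2 (headTail n w).2) :
          ℝ × EuclideanSpace ℝ (Fin n)) := by
  have h1 : HasMFDerivAt 𝓘(ℝ, 𝔼[n]) 𝓘(ℝ, ℝ) (fun z : 𝔼[n] => ε * (headTail n z).1) z
      (ε • (ContinuousLinearMap.fst ℝ ℝ (EuclideanSpace ℝ (Fin n))).comp
        (headTail n : 𝔼[n] →L[ℝ] ℝ × EuclideanSpace ℝ (Fin n))) :=
    (((ContinuousLinearMap.fst ℝ ℝ (EuclideanSpace ℝ (Fin n))).comp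
      (headTail n : 𝔼[n] →L[ℝ] ℝ × EuclideanSpace ℝ (Fin n))).hasFDerivAt.const_mul
        ε).hasMFDerivAt
  have h2 : HasMFDerivAt 𝓘(ℝ, 𝔼[n]) (𝓡 n) (fun z : 𝔼[n] => (headTail n z).2) z
      ((ContinuousLinearMap.snd ℝ ℝ (EuclideanSpace ℝ (Fin n))).comp
        (headTail n : 𝔼[n] →L[ℝ] ℝ × EuclideanSpace ℝ (Fin n))) :=
    ((ContinuousLinearMap.snd ℝ ℝ (EuclideanSpace ℝ (Fin n))).comp
      (headTail n : 𝔼[n] →L[ℝ] ℝ × EuclideanSpace ℝ (Fin n))).hasFDerivAt.hasMFDerivAt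
  have h3 : MDifferentiableAt (𝓡 n) (𝓡 n) e.symm (headTail n z).2 :=
    ((contMDiffOn_symm_of_mem_maximalAtlas (I := 𝓡 n) (n := ∞)
      (IsManifold.subset_maximalAtlas he)).contMDiffAt
        (e.open_target.mem_nhds (hr hz.2))).mdifferentiableAt (by simp)
  have h4 := h1.prodMk (h3.hasMFDerivAt.comp z h2)
  have h5 := ((ι.contMDiffAt (collarPoint_mem (e := e) hε hε' hz)).mdifferentiableAt
    (by simp)).hasMFDerivAt.comp z h4
  have h6 := h5.mfderiv
  exact congrArg (fun L : 𝔼[n] →L[ℝ] 𝔼[n] => L w) h6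

end

end

/-! ### Bounds for symbols -/

/-- Only the derivative of order zero is used; the exponential undoes the substitution $t=-\log s$.
-/
theorem IsSymbolOn.bound {xbar : ℝ} {U K : Set (EuclideanSpace ℝ (Fin n))}
    {b : ℝ → EuclideanSpace ℝ (Fin n) → ℝ} (hb : IsSymbolOn xbar U b) (hK : IsCompact K)
    (hKU : K ⊆ U) {s₀ : ℝ} (hs₀ : s₀ ∈ Ioo 0 xbar) :
    ∃ C : ℝ, 0 ≤ C ∧ ∀ s ∈ Ioc 0 s₀, ∀ z ∈ K, |b s z| ≤ C := by
  obtain ⟨C, hC⟩ := hb.2 K hKU hK s₀ hs₀ 0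
  refine ⟨max C 0, le_max_right _ _, fun s hs z hz => le_trans ?_ (le_max_left _ _)⟩
  have := hC s hs z hz
  rwa [norm_iteratedFDeriv_zero, neg_neg, Real.exp_log hs.1, Real.norm_eq_abs] at this

/-- The pullback of a bilinear form. -/
noncomputable def pullbackBilin {F W : Type*} [NormedAddCommGroup F] [NormedSpace ℝ F] [AddCommGroup W]
    [Module ℝ W] [TopologicalSpace W] (B : W →L[ℝ] W →L[ℝ] ℝ) (L : F →L[ℝ] W) :
    F →ₗ[ℝ] F →ₗ[ℝ] ℝ :=
  LinearMap.mk₂ ℝ (fun v w => B (L v) (L w)) (fun a b c => by rw [map_add, map_add, add_apply])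
    (fun t a b => by rw [map_smul, map_smul, smul_apply]) (fun a b c => by rw [map_add, map_add])
    (fun t a b => by rw [map_smul, map_smul])

theorem EuclideanSpace.eq_sum_smul_single {k : ℕ} (ξ : EuclideanSpace ℝ (Fin k)) :
    ξ = ∑ i, ξ i • EuclideanSpace.single i (1 : ℝ) := by
  conv_lhs => rw [← (EuclideanSpace.basisFun (Fin k) ℝ).sum_repr ξ]
  simp

/-- Symbol estimates bound components on basis vectors; this turns them into operator bounds. -/
theorem abs_le_sum_mul_norm {k : ℕ} (f : EuclideanSpace ℝ (Fin k) →ₗ[ℝ] ℝ) {C : Fin k → ℝ}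
    (hC : ∀ i, |f (EuclideanSpace.single i (1 : ℝ))| ≤ C i) (ξ : EuclideanSpace ℝ (Fin k)) :
    |f ξ| ≤ (∑ i, C i) * ‖ξ‖ := by
  conv_lhs => rw [EuclideanSpace.eq_sum_smul_single ξ]
  rw [map_sum, Finset.sum_mul]
  refine (Finset.abs_sum_le_sum_abs _ _).trans (Finset.sum_le_sum fun i _ => ?_)
  rw [map_smul, smul_eq_mul, abs_mul, mul_comm]
  exact mul_le_mul (hC i) (PiLp.norm_apply_le ξ i) (abs_nonneg _) ((abs_nonneg _).trans (hC i))

theorem abs_le_sum_mul_norm_sq {k : ℕ}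
    (f : EuclideanSpace ℝ (Fin k) →ₗ[ℝ] EuclideanSpace ℝ (Fin k) →ₗ[ℝ] ℝ) {C : Fin k → Fin k → ℝ}
    (hC : ∀ i j, |f (EuclideanSpace.single i (1 : ℝ)) (EuclideanSpace.single j (1 : ℝ))| ≤ C i j)
    (ξ : EuclideanSpace ℝ (Fin k)) :
    |f ξ ξ| ≤ (∑ i, ∑ j, C i j) * ‖ξ‖ ^ 2 := by
  have h1 : ∀ i, |f.flip ξ (EuclideanSpace.single i (1 : ℝ))| ≤ (∑ j, C i j) * ‖ξ‖ := fun i =>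
    abs_le_sum_mul_norm (f (EuclideanSpace.single i (1 : ℝ))) (hC i) ξ
  have h2 := abs_le_sum_mul_norm (f.flip ξ) h1 ξ
  rw [← Finset.sum_mul, mul_assoc, ← pow_two] at h2
  exact h2

section

variable {Y : Type*} [TopologicalSpace Y] [ChartedSpace (EuclideanSpace ℝ (Fin n)) Y]
  {xbar s₀ : ℝ} {e : OpenPartialHomeomorph Y (EuclideanSpace ℝ (Fin n))}
  {K : Set (EuclideanSpace ℝ (Fin n))}

theorem IsScalarSymbol.bound {a : ℝ → Y → ℝ} (ha : IsScalarSymbol (n := n) xbar a)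
    (he : e ∈ atlas (EuclideanSpace ℝ (Fin n)) Y) (hK : IsCompact K) (hKU : K ⊆ e.target)
    (hs₀ : s₀ ∈ Ioo 0 xbar) :
    ∃ C : ℝ, 0 ≤ C ∧ ∀ s ∈ Ioc 0 s₀, ∀ z ∈ K, |a s (e.symm z)| ≤ C :=
  (ha e he).bound hK hKU hs₀

theorem IsOneFormSymbol.bound {Γ : ℝ → ∀ y : Y, TangentSpace (𝓡 n) y →L[ℝ] ℝ}
    (hΓ : IsOneFormSymbol xbar Γ)
    (he : e ∈ atlas (EuclideanSpace ℝ (Fin n)) Y) (hK : IsCompact K) (hKU : K ⊆ e.target)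
    (hs₀ : s₀ ∈ Ioo 0 xbar) :
    ∃ C : ℝ, 0 ≤ C ∧ ∀ s ∈ Ioc 0 s₀, ∀ z ∈ K, ∀ ξ : EuclideanSpace ℝ (Fin n),
      |Γ s (e.symm z) (mfderiv (𝓡 n) (𝓡 n) e.symm z ξ)| ≤ C * ‖ξ‖ := by
  choose C hC0 hC using fun i : Fin n =>
    (hΓ e he (EuclideanSpace.single i (1 : ℝ))).bound hK hKU hs₀
  refine ⟨∑ i, C i, Finset.sum_nonneg fun i _ => hC0 i, fun s hs z hz ξ => ?_⟩
  exact abs_le_sum_mul_norm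
    ((Γ s (e.symm z)).comp (mfderiv (𝓡 n) (𝓡 n) e.symm z)).toLinearMap (fun i => hC i s hs z hz) ξ

theorem IsSymTwoTensorSymbol.bound
    {H : ℝ → ∀ y : Y, TangentSpace (𝓡 n) y →L[ℝ] TangentSpace (𝓡 n) y →L[ℝ] ℝ}
    (hH : IsSymTwoTensorSymbol xbar H)
    (he : e ∈ atlas (EuclideanSpace ℝ (Fin n)) Y) (hK : IsCompact K) (hKU : K ⊆ e.target)
    (hs₀ : s₀ ∈ Ioo 0 xbar) :
    ∃ C : ℝ, 0 ≤ C ∧ ∀ s ∈ Ioc 0 s₀, ∀ z ∈ K, ∀ ξ : EuclideanSpace ℝ (Fin n),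
      |H s (e.symm z) (mfderiv (𝓡 n) (𝓡 n) e.symm z ξ) (mfderiv (𝓡 n) (𝓡 n) e.symm z ξ)| ≤
        C * ‖ξ‖ ^ 2 := by
  choose C hC0 hC using fun i j : Fin n =>
    (hH.2 e he (EuclideanSpace.single i (1 : ℝ)) (EuclideanSpace.single j (1 : ℝ))).bound hK hKU hs₀
  refine ⟨∑ i, ∑ j, C i j, Finset.sum_nonneg fun i _ => Finset.sum_nonneg fun j _ => hC0 i j,
    fun s hs z hz ξ => ?_⟩
  exact abs_le_sum_mul_norm_sq (pullbackBilin (W := TangentSpace (𝓡 n) (e.symm z))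
    (H s (e.symm z)) (mfderiv (𝓡 n) (𝓡 n) e.symm z)) (fun i j => hC i j s hs z hz) ξ

/-- A Riemannian metric is comparable with the Euclidean metric, locally uniformly in a chart. -/
theorem riemannianMetric_bound [IsManifold (𝓡 n) ∞ Y]
    (h : Bundle.ContMDiffRiemannianMetric (𝓡 n) ∞ (EuclideanSpace ℝ (Fin n))
      (fun y : Y => TangentSpace (𝓡 n) y))
    (he : e ∈ atlas (EuclideanSpace ℝ (Fin n)) Y) (hK : IsCompact K) (hKU : K ⊆ e.target) :
    ∃ c C : ℝ, 0 < c ∧ 0 ≤ C ∧ ∀ z ∈ K, ∀ ξ : EuclideanSpace ℝ (Fin n),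
      c * ‖ξ‖ ^ 2 ≤ h.inner (e.symm z) (mfderiv (𝓡 n) (𝓡 n) e.symm z ξ)
        (mfderiv (𝓡 n) (𝓡 n) e.symm z ξ) ∧
      h.inner (e.symm z) (mfderiv (𝓡 n) (𝓡 n) e.symm z ξ)
        (mfderiv (𝓡 n) (𝓡 n) e.symm z ξ) ≤ C * ‖ξ‖ ^ 2 := by
  have hes := contMDiffOn_symm_of_mem_maximalAtlas (I := 𝓡 n) (n := ∞)
    (IsManifold.subset_maximalAtlas he)
  have het := contMDiffOn_of_mem_maximalAtlas (I := 𝓡 n) (n := ∞)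
    (IsManifold.subset_maximalAtlas he)
  set H : EuclideanSpace ℝ (Fin n) →
      EuclideanSpace ℝ (Fin n) →ₗ[ℝ] EuclideanSpace ℝ (Fin n) →ₗ[ℝ] ℝ :=
    fun z => pullbackBilin (W := TangentSpace (𝓡 n) (e.symm z)) (h.inner (e.symm z))
      (mfderiv (𝓡 n) (𝓡 n) e.symm z)
  have hsm : ∀ v w, ContinuousOn (fun z => H z v w) e.target := fun v w =>
    (contDiffOn_pullback_form (h.contMDiff.contMDiffOn (s := univ)) e.open_target hes
      (mapsTo_univ _ _) v w).continuousOn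
  have hexp : ∀ z ξ, H z ξ ξ = ∑ i, ∑ j, ξ i * (ξ j *
      H z (EuclideanSpace.single i (1 : ℝ)) (EuclideanSpace.single j (1 : ℝ))) := by
    intro z ξ
    conv_lhs => rw [EuclideanSpace.eq_sum_smul_single ξ]
    simp only [map_sum, map_smul, LinearMap.sum_apply, LinearMap.smul_apply, smul_eq_mul,
      Finset.mul_sum]
    rw [Finset.sum_comm]
    exact Finset.sum_congr rfl fun i _ => Finset.sum_congr rfl fun j _ => by ring
  have hinj : ∀ z ∈ e.target, ∀ ξ : EuclideanSpace ℝ (Fin n),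
      (mfderiv (𝓡 n) (𝓡 n) e.symm z ξ : EuclideanSpace ℝ (Fin n)) = 0 → ξ = 0 := by
    intro z hz ξ h0
    have h1 : e ∘ e.symm =ᶠ[𝓝 z] id := by
      filter_upwards [e.open_target.mem_nhds hz] with y hy using e.right_inv hy
    have h2 := mfderiv_comp z
      ((het.contMDiffAt (e.open_source.mem_nhds (e.map_target hz))).mdifferentiableAt (by simp))
      ((hes.contMDiffAt (e.open_target.mem_nhds hz)).mdifferentiableAt (by simp))
    rw [h1.mfderiv_eq, mfderiv_id] at h2
    have h3 := congrArg
      (fun L : EuclideanSpace ℝ (Fin n) →L[ℝ] EuclideanSpace ℝ (Fin n) => L ξ) h2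
    refine h3.trans ?_
    refine (congrArg (mfderiv (𝓡 n) (𝓡 n) e (e.symm z)) h0).trans ?_
    exact map_zero _
  -- Both constants come from compactness of $K$ times the unit sphere, followed by homogeneity of
  -- degree two.
  have hcont : ContinuousOn (fun q : EuclideanSpace ℝ (Fin n) × EuclideanSpace ℝ (Fin n) =>
      H q.1 q.2 q.2) (K ×ˢ Metric.sphere 0 1) := by
    simp only [hexp]
    refine continuousOn_finsetSum _ fun i _ => continuousOn_finsetSum _ fun j _ => ?_
    refine (by fun_prop : Continuous fun q : EuclideanSpace ℝ (Fin n) × EuclideanSpace ℝ (Fin n) =>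
      q.2 i).continuousOn.mul ((by fun_prop : Continuous
      fun q : EuclideanSpace ℝ (Fin n) × EuclideanSpace ℝ (Fin n) => q.2 j).continuousOn.mul ?_)
    exact (hsm _ _).comp continuousOn_fst fun q hq => hKU hq.1
  have hcpt := hK.prod (isCompact_sphere (0 : EuclideanSpace ℝ (Fin n)) 1)
  -- This form of the minimum needs no point in the compact set, which matters for $n=0$, when the
  -- unit sphere is empty.
  obtain ⟨c, hc, hc'⟩ := hcpt.exists_forall_le' hcont (a := 0) fun q hq => by
    refine h.pos _ _ fun h0 => ?_
    have := hinj q.1 (hKU hq.1) q.2 h0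
    have h1 := hq.2
    rw [this] at h1
    simp at h1
  obtain ⟨C, hC⟩ := hcpt.exists_bound_of_continuousOn hcont
  refine ⟨c, max C 0, hc, le_max_right _ _, fun z hz ξ => ?_⟩
  change c * ‖ξ‖ ^ 2 ≤ H z ξ ξ ∧ H z ξ ξ ≤ max C 0 * ‖ξ‖ ^ 2
  rcases eq_or_ne ξ 0 with rfl | hξ
  · simp
  have hn : 0 < ‖ξ‖ := norm_pos_iff.2 hξ
  have hu : (z, ‖ξ‖⁻¹ • ξ) ∈ K ×ˢ Metric.sphere (0 : EuclideanSpace ℝ (Fin n)) 1 := by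
    refine ⟨hz, ?_⟩
    simp [norm_smul, hn.ne']
  have hscale : H z ξ ξ = H z (‖ξ‖⁻¹ • ξ) (‖ξ‖⁻¹ • ξ) * ‖ξ‖ ^ 2 := by
    simp only [map_smul, LinearMap.smul_apply, smul_eq_mul]
    field_simp
  rw [hscale]
  refine ⟨mul_le_mul_of_nonneg_right (hc' _ hu) (sq_nonneg _),
    mul_le_mul_of_nonneg_right ?_ (sq_nonneg _)⟩
  exact (le_abs_self _).trans ((hC _ hu).trans (le_max_left _ _))

end

/-! ### The rescaled metric is uniformly comparable with the Euclidean metric -/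

/-- In the frame $dx/x^2$, $dy/x$ the vector has components of size $\alpha=a/s^2$ and $\beta=N/s$.
The leading part is $\alpha^2+h$, with $h$ comparable to $\beta^2$; every other term carries a
factor $s$ or $s^{1+\delta}\le s$. The total error is at most $s(|M|+4K)(\alpha^2+\beta^2)$, which
`hsmall` makes at most half of the lower bound. -/
theorem conic_form_bounds {s δ M K c C a N hη Γ h₁ A B D : ℝ} (hs : 0 < s) (hs1 : s ≤ 1)
    (hδ : 0 < δ) (hN : 0 ≤ N) (hK : 0 ≤ K) (hc1 : c ≤ 1) (hC1 : 1 ≤ C)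
    (hlo : c * N ^ 2 ≤ hη) (hhi : hη ≤ C * N ^ 2) (hΓ : |Γ| ≤ K * N) (hh₁ : |h₁| ≤ K * N ^ 2)
    (hA : |A| ≤ K) (hB : |B| ≤ K * N) (hD : |D| ≤ K * N ^ 2)
    (hsmall : s * (|M| + 4 * K) ≤ c / 2) :
    c / 2 * ((a / s ^ 2) ^ 2 + (N / s) ^ 2) ≤
      (1 / s ^ 4 + M / s ^ 3) * (a * a) + hη / s ^ 2 + (a * Γ + a * Γ) / s ^ 2 + h₁ / s
          + s ^ (1 + δ) * (A * (a * a) / s ^ 4 + (a * B + a * B) / s ^ 3 + D / s ^ 2) ∧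
      (1 / s ^ 4 + M / s ^ 3) * (a * a) + hη / s ^ 2 + (a * Γ + a * Γ) / s ^ 2 + h₁ / s
          + s ^ (1 + δ) * (A * (a * a) / s ^ 4 + (a * B + a * B) / s ^ 3 + D / s ^ 2) ≤
      2 * C * ((a / s ^ 2) ^ 2 + (N / s) ^ 2) := by
  -- Passing to components in the scattering frame clears all negative powers of $s$.
  obtain ⟨α, rfl⟩ : ∃ α, a = α * s ^ 2 := ⟨a / s ^ 2, by field_simp⟩
  obtain ⟨β, rfl⟩ : ∃ β, N = β * s := ⟨N / s, by field_simp⟩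
  obtain ⟨η, rfl⟩ : ∃ η, hη = η * s ^ 2 := ⟨hη / s ^ 2, by field_simp⟩
  obtain ⟨Γ, rfl⟩ : ∃ Γ', Γ = Γ' * s := ⟨Γ / s, by field_simp⟩
  obtain ⟨h₁, rfl⟩ : ∃ h', h₁ = h' * s ^ 2 := ⟨h₁ / s ^ 2, by field_simp⟩
  obtain ⟨B, rfl⟩ : ∃ B', B = B' * s := ⟨B / s, by field_simp⟩
  obtain ⟨D, rfl⟩ : ∃ D', D = D' * s ^ 2 := ⟨D / s ^ 2, by field_simp⟩
  have hs2 : 0 < s ^ 2 := by positivity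
  set σ := s ^ (1 + δ) with hσ
  have hσ0 : 0 ≤ σ := Real.rpow_nonneg hs.le _
  have hσs : σ ≤ s := by
    have := Real.rpow_le_rpow_of_exponent_ge hs hs1 (by linarith : (1 : ℝ) ≤ 1 + δ)
    rwa [Real.rpow_one] at this
  have hβ : 0 ≤ β := nonneg_of_mul_nonneg_left hN hs
  have e1 : (α * s ^ 2 / s ^ 2) ^ 2 + (β * s / s) ^ 2 = α ^ 2 + β ^ 2 := by field_simp
  have e2 : (1 / s ^ 4 + M / s ^ 3) * (α * s ^ 2 * (α * s ^ 2)) + η * s ^ 2 / s ^ 2 +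
      (α * s ^ 2 * (Γ * s) + α * s ^ 2 * (Γ * s)) / s ^ 2 + h₁ * s ^ 2 / s
      + σ * (A * (α * s ^ 2 * (α * s ^ 2)) / s ^ 4 +
        (α * s ^ 2 * (B * s) + α * s ^ 2 * (B * s)) / s ^ 3 + D * s ^ 2 / s ^ 2) =
      α ^ 2 + η + (s * (M * α ^ 2 + 2 * (α * Γ) + h₁) + σ * (A * α ^ 2 + 2 * (α * B) + D)) := by
    field_simp
    ring
  rw [e1, e2]
  have lo : c * β ^ 2 ≤ η := by
    rw [mul_pow, ← mul_assoc] at hlo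
    exact le_of_mul_le_mul_right hlo hs2
  have hi : η ≤ C * β ^ 2 := by
    rw [mul_pow, ← mul_assoc] at hhi
    exact le_of_mul_le_mul_right hhi hs2
  have bΓ : |Γ| ≤ K * β := by
    rw [abs_mul, abs_of_pos hs, ← mul_assoc] at hΓ
    exact le_of_mul_le_mul_right hΓ hs
  have bB : |B| ≤ K * β := by
    rw [abs_mul, abs_of_pos hs, ← mul_assoc] at hB
    exact le_of_mul_le_mul_right hB hs
  have bh : |h₁| ≤ K * β ^ 2 := by
    rw [abs_mul, abs_of_pos hs2, mul_pow, ← mul_assoc] at hh₁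
    exact le_of_mul_le_mul_right hh₁ hs2
  have bD : |D| ≤ K * β ^ 2 := by
    rw [abs_mul, abs_of_pos hs2, mul_pow, ← mul_assoc] at hD
    exact le_of_mul_le_mul_right hD hs2
  -- The mixed terms are controlled by $2|\alpha|\beta\le\alpha^2+\beta^2$.
  have cross : ∀ t, |t| ≤ K * β → |2 * (α * t)| ≤ K * (α ^ 2 + β ^ 2) := by
    intro t ht
    rw [abs_mul, abs_mul, abs_two]
    have h1 : |α| * |t| ≤ |α| * (K * β) := mul_le_mul_of_nonneg_left ht (abs_nonneg _)
    have h2 := mul_nonneg hK (sq_nonneg (|α| - β))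
    have h3 := sq_abs α
    nlinarith
  have bA : |A * α ^ 2| ≤ K * α ^ 2 := by
    rw [abs_mul, abs_of_nonneg (sq_nonneg α)]
    exact mul_le_mul_of_nonneg_right hA (sq_nonneg α)
  have bM : |M * α ^ 2| = |M| * α ^ 2 := by
    rw [abs_mul, abs_of_nonneg (sq_nonneg α)]
  have E1 : |M * α ^ 2 + 2 * (α * Γ) + h₁| ≤ |M| * α ^ 2 + K * (α ^ 2 + β ^ 2) + K * β ^ 2 :=
    (abs_add_le _ _).trans (add_le_add ((abs_add_le _ _).trans
      (add_le_add bM.le (cross _ bΓ))) bh)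
  have E2 : |A * α ^ 2 + 2 * (α * B) + D| ≤ K * α ^ 2 + K * (α ^ 2 + β ^ 2) + K * β ^ 2 :=
    (abs_add_le _ _).trans (add_le_add ((abs_add_le _ _).trans (add_le_add bA (cross _ bB))) bD)
  have E3 : |s * (M * α ^ 2 + 2 * (α * Γ) + h₁) + σ * (A * α ^ 2 + 2 * (α * B) + D)| ≤
      c / 2 * (α ^ 2 + β ^ 2) := by
    have hMβ : 0 ≤ |M| * β ^ 2 := by positivity
    have hKα : 0 ≤ K * α ^ 2 := by positivity
    have hX : 0 ≤ K * α ^ 2 + K * (α ^ 2 + β ^ 2) + K * β ^ 2 := by positivity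
    calc _ ≤ s * (|M| * α ^ 2 + K * (α ^ 2 + β ^ 2) + K * β ^ 2) +
          s * (K * α ^ 2 + K * (α ^ 2 + β ^ 2) + K * β ^ 2) := by
          refine (abs_add_le _ _).trans (add_le_add ?_ ?_)
          · rw [abs_mul, abs_of_pos hs]
            exact mul_le_mul_of_nonneg_left E1 hs.le
          · rw [abs_mul, abs_of_nonneg hσ0]
            exact mul_le_mul hσs E2 (abs_nonneg _) hs.le
      _ ≤ s * ((|M| + 4 * K) * (α ^ 2 + β ^ 2)) := by
          rw [← mul_add]
          refine mul_le_mul_of_nonneg_left ?_ hs.le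
          linarith
      _ ≤ c / 2 * (α ^ 2 + β ^ 2) := by
          rw [← mul_assoc]
          exact mul_le_mul_of_nonneg_right hsmall (by positivity)
  have E4 := abs_le.1 E3
  have hα1 : c * α ^ 2 ≤ α ^ 2 := mul_le_of_le_one_left (sq_nonneg _) hc1
  have hα2 : α ^ 2 ≤ C * α ^ 2 := le_mul_of_one_le_left (sq_nonneg _) hC1
  have hcC : c / 2 * (α ^ 2 + β ^ 2) ≤ C * (α ^ 2 + β ^ 2) :=
    mul_le_mul_of_nonneg_right (by linarith) (by positivity)
  constructor <;> linarith [E4.1, E4.2]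

theorem exists_pos_forall_of_tendsto_zero {f : ℝ → ℝ} (hf : ContinuousAt f 0) (h0 : f 0 = 0)
    {c : ℝ} (hc : 0 < c) : ∃ s₁ > 0, ∀ s ∈ Ioo 0 s₁, f s ≤ c := by
  have : ∀ᶠ s in 𝓝 0, f s < c := hf.eventually (gt_mem_nhds (by rwa [h0]))
  obtain ⟨r, hr, h⟩ := Metric.eventually_nhds_iff.1 this
  refine ⟨r, hr, fun s hs => (h ?_).le⟩
  rw [Real.dist_eq, sub_zero, abs_of_pos hs.1]
  exact hs.2

/-- Bounds of the data on the box `(1, 2) × B`, in collar coordinates rescaled by `ε`. -/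
structure RescaledBounds (G : 𝔼[n] → Matrix (Fin (n + 1)) (Fin (n + 1)) ℝ) (F W : 𝔼[n] → ℝ)
    (U : Set 𝔼[n]) (ε c C κ : ℝ) : Prop where
  form_lower : ∀ z ∈ U, ∀ w : 𝔼[n], c / ε ^ 2 * ‖w‖ ^ 2 ≤ w.ofLp ⬝ᵥ (G z).mulVec w.ofLp
  form_upper : ∀ z ∈ U, ∀ w : 𝔼[n], w.ofLp ⬝ᵥ (G z).mulVec w.ofLp ≤ C / ε ^ 2 * ‖w‖ ^ 2
  lapse_lower : ∀ z ∈ U, 1 / 4 ≤ F z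
  lapse_upper : ∀ z ∈ U, F z ≤ 4
  potential : ∀ z ∈ U, W z ≤ -(κ * ε)

section

variable {X : Type*} [TopologicalSpace X] [ChartedSpace (EuclideanHalfSpace (n + 1)) X]
  {Y : Type*} [TopologicalSpace Y] [ChartedSpace (EuclideanSpace ℝ (Fin n)) Y]
  {x : X → ℝ} {xbar : ℝ}

/-- With $s=\varepsilon t$, $1<t<2$, and $a=\varepsilon w_0$, the scattering components are
$a/s^2=w_0/(\varepsilon t^2)$ and $\|\xi\|/s=\|\xi\|/(\varepsilon t)$. Both are of order
$1/\varepsilon$, which is the point of rescaling $x$ but not $y$. -/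
theorem paramGram_collarParam_bounds [IsManifold (𝓡 n) ∞ Y]
    [IsManifold (𝓡∂ (n + 1)) ∞ X] (hxbar : 0 < xbar) (ι : Collar n Y x xbar) {δ M : ℝ} (hδ : 0 < δ)
    {h : Bundle.ContMDiffRiemannianMetric (𝓡 n) ∞ (EuclideanSpace ℝ (Fin n))
      (fun y : Y => TangentSpace (𝓡 n) y)} {g : FormField n X} (hconic : IsConicMetric ι δ M h g)
    {e : OpenPartialHomeomorph Y (EuclideanSpace ℝ (Fin n))}
    (he : e ∈ atlas (EuclideanSpace ℝ (Fin n)) Y) {c : EuclideanSpace ℝ (Fin n)} {r : ℝ}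
    (hr : Metric.closedBall c r ⊆ e.target) :
    ∃ ε₀ > 0, ∃ c₁ > 0, ∃ C₁ > 0, ∀ ε ∈ Ioo 0 ε₀, ∀ z ∈ unitBox c r, ∀ w : 𝔼[n],
      c₁ / ε ^ 2 * ‖w‖ ^ 2 ≤ w.ofLp ⬝ᵥ (paramGram g (collarParam ι e ε) z).mulVec w.ofLp ∧
      w.ofLp ⬝ᵥ (paramGram g (collarParam ι e ε) z).mulVec w.ofLp ≤ C₁ / ε ^ 2 * ‖w‖ ^ 2 := by
  obtain ⟨Γ, h₁, A, B, D, hΓ, hh₁, hA, hB, hD, hg⟩ := hconic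
  have hcpt := isCompact_closedBall c r
  have hs₀ : xbar / 2 ∈ Ioo 0 xbar := ⟨by linarith, by linarith⟩
  obtain ⟨K₁, p₁, b₁⟩ := hΓ.bound he hcpt hr hs₀
  obtain ⟨K₂, p₂, b₂⟩ := hh₁.bound he hcpt hr hs₀
  obtain ⟨K₃, p₃, b₃⟩ := hA.bound he hcpt hr hs₀
  obtain ⟨K₄, p₄, b₄⟩ := hB.bound he hcpt hr hs₀
  obtain ⟨K₅, p₅, b₅⟩ := hD.bound he hcpt hr hs₀
  obtain ⟨cl, Cu, hcl, hCu, bh⟩ := riemannianMetric_bound h he hcpt hr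
  set K := K₁ + K₂ + K₃ + K₄ + K₅ with hK
  have hK0 : 0 ≤ K := by positivity
  -- The leading coefficient in the normal direction is $1$, so the lower constant must be at most
  -- $1$ and the upper one at least $1$.
  set c₀ := min cl 1 with hc₀
  have hc₀pos : 0 < c₀ := lt_min hcl one_pos
  set C₀ := Cu + 1 with hC₀
  obtain ⟨s₁, hs₁, hsm⟩ := exists_pos_forall_of_tendsto_zero
    (f := fun s : ℝ => s * (|M| + 4 * K)) (by fun_prop) (by simp) (half_pos hc₀pos)
  -- The final halving accounts for $s<2\varepsilon$. The constant $c_0/32$ is $c_0/2$ divided by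
  -- the bound $16$ for $t^4$ and $t^2$; the upper constant loses nothing because $t>1$.
  refine ⟨min (min 1 s₁) (xbar / 2) / 2, by positivity, c₀ / 32, by positivity, 2 * C₀,
    by positivity, fun ε hε z hz w => ?_⟩
  have hε0 : 0 < ε := hε.1
  have hε1 : 2 * ε < 1 ∧ 2 * ε < s₁ ∧ 2 * ε < xbar / 2 := by
    have h1 : 2 * ε < min (min 1 s₁) (xbar / 2) := by linarith [hε.2]
    exact ⟨h1.trans_le ((min_le_left _ _).trans (min_le_left _ _)),
      h1.trans_le ((min_le_left _ _).trans (min_le_right _ _)), h1.trans_le (min_le_right _ _)⟩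
  have hεx : 2 * ε ≤ xbar := by linarith [hε1.2.2]
  set t := (headTail n z).1 with ht
  have ht1 : 1 < t := hz.1.1
  have ht2 : t < 2 := hz.1.2
  set s := ε * t with hs
  have hs0 : 0 < s := by positivity
  have hs2 : s < 2 * ε := by nlinarith
  have hsmem : s ∈ Ioc 0 (xbar / 2) := ⟨hs0, by linarith [hε1.2.2]⟩
  have hzc : (headTail n z).2 ∈ Metric.closedBall c r := Metric.ball_subset_closedBall hz.2
  have hball : Metric.ball c r ⊆ e.target := Metric.ball_subset_closedBall.trans hr
  set ξ := (headTail n w).2 with hξ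
  set z' := (headTail n z).2 with hz'
  have hform := hg s ⟨hs0, by linarith [hε1.2.2]⟩ (e.symm z') (ε * (headTail n w).1)
    (ε * (headTail n w).1) (mfderiv (𝓡 n) (𝓡 n) e.symm z' ξ) (mfderiv (𝓡 n) (𝓡 n) e.symm z' ξ)
  have hgram : w.ofLp ⬝ᵥ (paramGram g (collarParam ι e ε) z).mulVec w.ofLp = _ :=
    (dotProduct_paramGram_mulVec g (collarParam ι e ε) z w w).trans
      ((congrArg₂ (fun v v' : 𝔼[n] => g (collarParam ι e ε z) v v')
        (mfderiv_collarParam ι he hball hε0 hεx hz w)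
        (mfderiv_collarParam ι he hball hε0 hεx hz w)).trans hform)
  have hN := sq_nonneg ‖ξ‖
  have hN' := norm_nonneg ξ
  have key := conic_form_bounds (a := ε * (headTail n w).1) (C := C₀) (M := M) hs0
    (by linarith [hε1.1]) hδ hN' hK0
    (min_le_right cl 1) (by linarith)
    ((mul_le_mul_of_nonneg_right (min_le_left cl 1) hN).trans (bh z' hzc ξ).1)
    ((bh z' hzc ξ).2.trans (mul_le_mul_of_nonneg_right (by linarith) hN))
    ((b₁ s hsmem z' hzc ξ).trans (mul_le_mul_of_nonneg_right (by linarith) hN'))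
    ((b₂ s hsmem z' hzc ξ).trans (mul_le_mul_of_nonneg_right (by linarith) hN))
    ((b₃ s hsmem z' hzc).trans (by linarith))
    ((b₄ s hsmem z' hzc ξ).trans (mul_le_mul_of_nonneg_right (by linarith) hN'))
    ((b₅ s hsmem z' hzc ξ).trans (mul_le_mul_of_nonneg_right (by linarith) hN))
    (hsm s ⟨hs0, by linarith [hε1.2.1]⟩)
  rw [hgram]
  have hq : (ε * (headTail n w).1 / s ^ 2) ^ 2 + (‖ξ‖ / s) ^ 2 =
      ((headTail n w).1 ^ 2 / t ^ 4 + ‖ξ‖ ^ 2 / t ^ 2) / ε ^ 2 := by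
    rw [hs]
    have : t ≠ 0 := by positivity
    field_simp
  have hw := norm_sq_headTail w
  have hlow : ‖w‖ ^ 2 / 16 ≤ (headTail n w).1 ^ 2 / t ^ 4 + ‖ξ‖ ^ 2 / t ^ 2 := by
    have h4 : t ^ 4 ≤ 16 := by
      have := pow_le_pow_left₀ (by positivity) ht2.le 4
      linarith
    have h2 : t ^ 2 ≤ 16 := by
      have := pow_le_pow_left₀ (by positivity) ht2.le 2
      linarith
    rw [hw, add_div]
    exact add_le_add (div_le_div_of_nonneg_left (sq_nonneg _) (by positivity) h4)
      (div_le_div_of_nonneg_left hN (by positivity) h2)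
  have hup : (headTail n w).1 ^ 2 / t ^ 4 + ‖ξ‖ ^ 2 / t ^ 2 ≤ ‖w‖ ^ 2 := by
    rw [hw]
    exact add_le_add (div_le_self (sq_nonneg _) (one_le_pow₀ ht1.le))
      (div_le_self hN (one_le_pow₀ ht1.le))
  rw [hq] at key
  constructor
  · refine le_trans (le_of_eq_of_le ?_ (mul_le_mul_of_nonneg_left
      (div_le_div_of_nonneg_right hlow (sq_nonneg ε)) (half_pos hc₀pos).le)) key.1
    ring
  · refine key.2.trans (le_of_le_of_eq (mul_le_mul_of_nonneg_left
      (div_le_div_of_nonneg_right hup (sq_nonneg ε)) (by positivity)) ?_)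
    ring

end

/-! ### Bounds for the lapse and the potential, and localization near a boundary point -/

section

variable {X : Type*} [TopologicalSpace X] [ChartedSpace (EuclideanHalfSpace (n + 1)) X]
  {Y : Type*} [TopologicalSpace Y] [ChartedSpace (EuclideanSpace ℝ (Fin n)) Y]
  {x : X → ℝ} {xbar : ℝ}

/-- The $\beth$ and $V$ terms are $s\cdot O(s^\delta)$; `h2` lets them use up at most half of the
negative main term $sm^2\aleph$. -/
theorem lapse_potential_bounds {s δ aleph m β v Kb Kv : ℝ} (hs : 0 < s) (hβ : |β| ≤ Kb)
    (hv : |s ^ (-(1 + δ)) * v| ≤ Kv)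
    (h1 : s * |aleph| + s ^ (1 + δ) * Kb ≤ 3 / 4)
    (h2 : s ^ δ * (m ^ 2 * Kb + 4 * Kv) ≤ -(m ^ 2 * aleph) / 2) :
    1 / 4 ≤ 1 + s * aleph + s ^ (1 + δ) * β ∧ 1 + s * aleph + s ^ (1 + δ) * β ≤ 4 ∧
    s * m ^ 2 * aleph + s ^ (1 + δ) * m ^ 2 * β + (1 + s * aleph + s ^ (1 + δ) * β) * v ≤
      s * (m ^ 2 * aleph / 2) := by
  set σ := s ^ (1 + δ) with hσ
  have hσ0 : 0 < σ := Real.rpow_pos_of_pos hs _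
  have hσs : σ = s * s ^ δ := by rw [hσ, Real.rpow_add hs, Real.rpow_one]
  have hKb : 0 ≤ Kb := (abs_nonneg _).trans hβ
  have e1 : |s * aleph + σ * β| ≤ 3 / 4 := by
    refine (abs_add_le _ _).trans (le_trans (add_le_add ?_ ?_) h1)
    · rw [abs_mul, abs_of_pos hs]
    · rw [abs_mul, abs_of_pos hσ0]
      exact mul_le_mul_of_nonneg_left hβ hσ0.le
  have e2 := abs_le.1 e1
  have hvσ : |v| ≤ σ * Kv := by
    have h3 : v = σ * (s ^ (-(1 + δ)) * v) := by
      rw [Real.rpow_neg hs.le, ← hσ, ← mul_assoc, mul_inv_cancel₀ hσ0.ne', one_mul]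
    rw [h3, abs_mul, abs_of_pos hσ0]
    exact mul_le_mul_of_nonneg_left hv hσ0.le
  have hF1 : 1 / 4 ≤ 1 + s * aleph + σ * β := by linarith [e2.1]
  have hF2 : 1 + s * aleph + σ * β ≤ 4 := by linarith [e2.2]
  refine ⟨hF1, hF2, ?_⟩
  have e3 : (1 + s * aleph + σ * β) * v ≤ 4 * (σ * Kv) := by
    refine (le_abs_self _).trans ?_
    rw [abs_mul, abs_of_pos (by linarith : 0 < 1 + s * aleph + σ * β)]
    exact mul_le_mul hF2 hvσ (abs_nonneg _) (by norm_num)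
  have e4 : σ * m ^ 2 * β ≤ σ * (m ^ 2 * Kb) := by
    rw [mul_assoc]
    exact mul_le_mul_of_nonneg_left
      (mul_le_mul_of_nonneg_left ((le_abs_self _).trans hβ) (sq_nonneg m)) hσ0.le
  have e5 : σ * (m ^ 2 * Kb) + 4 * (σ * Kv) ≤ s * (-(m ^ 2 * aleph) / 2) := by
    refine le_trans (le_of_eq ?_) (mul_le_mul_of_nonneg_left h2 hs.le)
    rw [hσs]
    ring
  linarith

theorem collarParam_lapse_potential_bounds (hxbar : 0 < xbar) (ι : Collar n Y x xbar)
    {δ aleph m : ℝ} (hδ : 0 < δ) (hm : 0 < m) (haleph : aleph < 0) {beth V : X → ℝ}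
    (hbeth : MemSymbol ι 0 beth) (hV : MemSymbol ι (-(1 + δ)) V)
    {e : OpenPartialHomeomorph Y (EuclideanSpace ℝ (Fin n))}
    (he : e ∈ atlas (EuclideanSpace ℝ (Fin n)) Y) {c : EuclideanSpace ℝ (Fin n)} {r : ℝ}
    (hr : Metric.closedBall c r ⊆ e.target) :
    ∃ ε₀ > 0, ∃ κ > 0, ∀ ε ∈ Ioo 0 ε₀, ∀ z ∈ unitBox c r,
      1 / 4 ≤ lapse x δ aleph beth (collarParam ι e ε z) ∧
      lapse x δ aleph beth (collarParam ι e ε z) ≤ 4 ∧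
      effPotential x δ aleph m beth V (collarParam ι e ε z) ≤ -(κ * ε) := by
  have hcpt := isCompact_closedBall c r
  have hs₀ : xbar / 2 ∈ Ioo 0 xbar := ⟨by linarith, by linarith⟩
  obtain ⟨Kb, -, bb⟩ := hbeth.2.bound he hcpt hr hs₀
  obtain ⟨Kv, -, bv⟩ := hV.2.bound he hcpt hr hs₀
  have hma : 0 < -(m ^ 2 * aleph) := by
    have := mul_pos (pow_pos hm 2) (neg_pos.2 haleph)
    linarith
  obtain ⟨s₁, hs₁, hsm₁⟩ := exists_pos_forall_of_tendsto_zero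
    (f := fun s : ℝ => s * |aleph| + s ^ (1 + δ) * Kb)
    ((continuousAt_id.mul continuousAt_const).add
      ((Real.continuousAt_rpow_const _ _ (Or.inr (by linarith))).mul continuousAt_const))
    (by simp [Real.zero_rpow (by linarith : 1 + δ ≠ 0)]) (by norm_num : (0 : ℝ) < 3 / 4)
  obtain ⟨s₂, hs₂, hsm₂⟩ := exists_pos_forall_of_tendsto_zero
    (f := fun s : ℝ => s ^ δ * (m ^ 2 * Kb + 4 * Kv))
    ((Real.continuousAt_rpow_const _ _ (Or.inr hδ.le)).mul continuousAt_const)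
    (by simp [Real.zero_rpow hδ.ne']) (half_pos hma)
  refine ⟨min (min s₁ s₂) (xbar / 2) / 2, by positivity, -(m ^ 2 * aleph) / 2, half_pos hma,
    fun ε hε z hz => ?_⟩
  have hε0 : 0 < ε := hε.1
  have hε1 : 2 * ε < s₁ ∧ 2 * ε < s₂ ∧ 2 * ε < xbar / 2 := by
    have h1 : 2 * ε < min (min s₁ s₂) (xbar / 2) := by linarith [hε.2]
    exact ⟨h1.trans_le ((min_le_left _ _).trans (min_le_left _ _)),
      h1.trans_le ((min_le_left _ _).trans (min_le_right _ _)), h1.trans_le (min_le_right _ _)⟩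
  have hεx : 2 * ε ≤ xbar := by linarith [hε1.2.2]
  have hxz := x_collarParam ι (e := e) hε0 hεx hz
  have ht1 : 1 < (headTail n z).1 := hz.1.1
  have ht2 : (headTail n z).1 < 2 := hz.1.2
  have hzc : (headTail n z).2 ∈ Metric.closedBall c r := Metric.ball_subset_closedBall hz.2
  set s := ε * (headTail n z).1 with hs
  have hs0 : 0 < s := mul_pos hε0 (by linarith)
  have hs1 : ε ≤ s := by nlinarith
  have hs2 : s < 2 * ε := by nlinarith
  have hsmem : s ∈ Ioc 0 (xbar / 2) := ⟨hs0, by linarith [hε1.2.2]⟩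
  have hb := bb s hsmem _ hzc
  rw [Real.rpow_zero, one_mul] at hb
  have := lapse_potential_bounds (m := m) hs0 hb (bv s hsmem _ hzc)
    (hsm₁ s ⟨hs0, by linarith [hε1.1]⟩) (hsm₂ s ⟨hs0, by linarith [hε1.2.1]⟩)
  simp only [lapse, effPotential, hxz]
  refine ⟨this.1, this.2.1, this.2.2.trans ?_⟩
  -- The coefficient $m^2\aleph/2$ is negative, so $s\ge\varepsilon$ gives the bound with
  -- $\kappa=-m^2\aleph/2$.
  nlinarith

/-- As $\varepsilon$ and $r$ shrink, the boxes collapse to a boundary point, so they all fit in one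
chart domain of $X$, as the volume computation requires. -/
theorem exists_collarParam_subset (hxbar : 0 < xbar) (ι : Collar n Y x xbar)
    {e : OpenPartialHomeomorph Y (EuclideanSpace ℝ (Fin n))} {c : EuclideanSpace ℝ (Fin n)}
    (hc : c ∈ e.target) {S : Set X} (hS : IsOpen S) (hcS : ι.toFun (0, e.symm c) ∈ S) :
    ∃ r > 0, Metric.closedBall c r ⊆ e.target ∧ ∃ ε₀ > 0, ∀ ε ∈ Ioo 0 ε₀, 2 * ε ≤ xbar ∧
      collarParam ι e ε '' unitBox c r ⊆ S := by
  have h0 : ((0 : ℝ), e.symm c) ∈ ι.source := by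
    rw [ι.source_eq]
    exact ⟨⟨le_rfl, hxbar⟩, mem_univ _⟩
  -- At $s=0$ the collar map is continuous only within its source, hence the implication.
  have h1 : ∀ᶠ q in 𝓝 ((0 : ℝ), e.symm c), q ∈ ι.source → ι.toFun q ∈ S :=
    eventually_nhdsWithin_iff.1
      ((ι.smooth_toFun.continuousOn _ h0).preimage_mem_nhdsWithin (hS.mem_nhds hcS))
  have h2 : ContinuousAt (fun q : ℝ × EuclideanSpace ℝ (Fin n) => (q.1, e.symm q.2)) (0, c) :=
    continuousAt_fst.prodMk ((e.continuousAt_symm hc).comp_of_eq continuousAt_snd rfl)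
  obtain ⟨r₁, hr₁, hball⟩ := Metric.eventually_nhds_iff.1 (h2.eventually h1)
  obtain ⟨r₂, hr₂, hball₂⟩ := Metric.isOpen_iff.1 e.open_target c hc
  refine ⟨min r₁ r₂ / 2, by positivity, ?_, min r₁ xbar / 2, by positivity, fun ε hε => ?_⟩
  · refine (Metric.closedBall_subset_ball ?_).trans hball₂
    have : min r₁ r₂ ≤ r₂ := min_le_right _ _
    have : 0 < min r₁ r₂ := lt_min hr₁ hr₂
    linarith
  · have e1 : 2 * ε < r₁ := by linarith [hε.2, min_le_left r₁ xbar]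
    have e2 : 2 * ε < xbar := by linarith [hε.2, min_le_right r₁ xbar]
    refine ⟨e2.le, ?_⟩
    rintro _ ⟨z, hz, rfl⟩
    have hm := collarPoint_mem (e := e) hε.1 e2.le hz
    refine hball (y := (ε * (headTail n z).1, (headTail n z).2)) ?_ (ι.mem_source hm)
    have e3 : ε * (headTail n z).1 < 2 * ε := by nlinarith [hz.1.2, hε.1]
    have e4 : 0 < ε * (headTail n z).1 := hm.1
    have e5 := Metric.mem_ball.1 hz.2
    refine max_lt ?_ ?_
    · rw [Real.dist_eq, sub_zero, abs_of_pos e4]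
      linarith
    · have : min r₁ r₂ ≤ r₁ := min_le_left _ _
      have : 0 < min r₁ r₂ := lt_min hr₁ hr₂
      linarith

end

/-! ### Negativity of the quadratic form -/

section LinearAlgebra

variable {G : Matrix (Fin (n + 1)) (Fin (n + 1)) ℝ} {a b : ℝ}

/-- An eigenvalue is the value of the form on its unit eigenvector. -/
theorem eigenvalues_mem_Icc (hG : G.IsHermitian)
    (hlo : ∀ w : 𝔼[n], a * ‖w‖ ^ 2 ≤ w.ofLp ⬝ᵥ G.mulVec w.ofLp)
    (hhi : ∀ w : 𝔼[n], w.ofLp ⬝ᵥ G.mulVec w.ofLp ≤ b * ‖w‖ ^ 2) (i : Fin (n + 1)) :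
    hG.eigenvalues i ∈ Icc a b := by
  have h1 := hG.eigenvalues_eq i
  have h2 : ‖hG.eigenvectorBasis i‖ = 1 := hG.eigenvectorBasis.orthonormal.1 i
  have h3 := hlo (hG.eigenvectorBasis i)
  have h4 := hhi (hG.eigenvectorBasis i)
  rw [h2, one_pow, mul_one] at h3 h4
  simp only [star_trivial, RCLike.re_to_real] at h1
  rw [h1]
  exact ⟨h3, h4⟩

theorem det_mem_Icc (hG : G.IsHermitian) (ha : 0 ≤ a)
    (hlo : ∀ w : 𝔼[n], a * ‖w‖ ^ 2 ≤ w.ofLp ⬝ᵥ G.mulVec w.ofLp)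
    (hhi : ∀ w : 𝔼[n], w.ofLp ⬝ᵥ G.mulVec w.ofLp ≤ b * ‖w‖ ^ 2) :
    G.det ∈ Icc (a ^ (n + 1)) (b ^ (n + 1)) := by
  have h := eigenvalues_mem_Icc hG hlo hhi
  rw [hG.det_eq_prod_eigenvalues]
  simp only [RCLike.ofReal_real_eq_id, id]
  constructor
  · have := Finset.prod_le_prod (s := Finset.univ) (fun i _ => ha) fun i _ => (h i).1
    simpa using this
  · have := Finset.prod_le_prod (s := Finset.univ) (fun i _ => ha.trans (h i).1) fun i _ => (h i).2
    simpa using this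

/-- With $u=G^{-1}v$ one has $a\|u\|^2\le\langle u,Gu\rangle=\langle u,v\rangle\le\|u\|\|v\|$, so
$\|u\|\le\|v\|/a$. -/
theorem dotProduct_inv_mulVec_le (hG : G.PosDef) (ha : 0 < a)
    (hlo : ∀ w : 𝔼[n], a * ‖w‖ ^ 2 ≤ w.ofLp ⬝ᵥ G.mulVec w.ofLp) (v : 𝔼[n]) :
    v.ofLp ⬝ᵥ (G⁻¹).mulVec v.ofLp ≤ ‖v‖ ^ 2 / a := by
  set u : 𝔼[n] := WithLp.toLp 2 ((G⁻¹).mulVec v.ofLp) with hu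
  have h1 := hlo u
  have h2 : G.mulVec u.ofLp = v.ofLp := by
    rw [hu]
    simp only [Matrix.mulVec_mulVec, Matrix.mul_nonsing_inv _ hG.det_pos.ne'.isUnit,
      Matrix.one_mulVec]
  rw [h2] at h1
  have h3 : v.ofLp ⬝ᵥ (G⁻¹).mulVec v.ofLp = inner ℝ u v := by
    rw [EuclideanSpace.inner_eq_star_dotProduct, star_trivial]
  have h4 : u.ofLp ⬝ᵥ v.ofLp = inner ℝ u v := by
    rw [EuclideanSpace.inner_eq_star_dotProduct, star_trivial, dotProduct_comm]
  rw [h4] at h1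
  rw [h3]
  have h5 := real_inner_le_norm u v
  have h6 : a * ‖u‖ ≤ ‖v‖ := by
    rcases (norm_nonneg u).eq_or_lt with h0 | h0
    · rw [← h0, mul_zero]
      exact norm_nonneg v
    · refine le_of_mul_le_mul_right ?_ h0
      nlinarith
  rw [le_div_iff₀ ha]
  nlinarith [norm_nonneg v, norm_nonneg u]

end LinearAlgebra

theorem coordGradPairing_self_le {G : 𝔼[n] → Matrix (Fin (n + 1)) (Fin (n + 1)) ℝ} {a : ℝ}
    {z : 𝔼[n]} (hG : (G z).PosDef) (ha : 0 < a)
    (hlo : ∀ w : 𝔼[n], a * ‖w‖ ^ 2 ≤ w.ofLp ⬝ᵥ (G z).mulVec w.ofLp) (u : 𝔼[n] → ℝ) :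
    coordGradPairing G u u z ≤ (∑ j, coordGrad u z j ^ 2) / a := by
  rw [coordGradPairing_eq]
  have := dotProduct_inv_mulVec_le hG ha hlo (WithLp.toLp 2 (coordGrad u z))
  rwa [EuclideanSpace.real_norm_sq_eq] at this

theorem coordGradPairing_self_nonneg {G : 𝔼[n] → Matrix (Fin (n + 1)) (Fin (n + 1)) ℝ}
    {z : 𝔼[n]} (hG : (G z).PosDef) (u : 𝔼[n] → ℝ) : 0 ≤ coordGradPairing G u u z := by
  rw [coordGradPairing_eq]
  simpa only [star_trivial] using hG.inv.posSemidef.dotProduct_mulVec_nonneg (coordGrad u z)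

/-- The scaling argument. The density lies between $R$ and $qR$ with $R=(c/\varepsilon^2)^{(n+1)/2}$
and $q=(C/c)^{(n+1)/2}$ independent of $\varepsilon$; the gradient term gains $\varepsilon^2/c$ and
the potential term is at most $-\kappa\varepsilon b^2/2$ before the density. Altogether the energy
is at most $R\varepsilon(\varepsilon T-\kappa B/2)$. The threshold depends only on $b$, $c$, $C$,
$\kappa$, so it serves all the metrics of the rescaled family. -/
theorem exists_forall_energy_neg {U : Set 𝔼[n]} (hU : IsOpen U) {b : 𝔼[n] → ℝ}
    (hb : ContDiff ℝ ∞ b) (hbc : HasCompactSupport b) (hbU : tsupport b ⊆ U) {z₀ : 𝔼[n]}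
    (hz₀ : b z₀ ≠ 0) {c C κ : ℝ} (hc : 0 < c) (hC : 0 < C) (hκ : 0 < κ) :
    ∃ ε₀ > 0, ∀ ε ∈ Ioo 0 ε₀, ∀ (G : 𝔼[n] → Matrix (Fin (n + 1)) (Fin (n + 1)) ℝ)
      (F W : 𝔼[n] → ℝ), IsMetricOn G U → ContinuousOn F U → ContinuousOn W U →
      RescaledBounds G F W U ε c C κ →
      ∫ z in U, Real.sqrt (G z).det * (Real.sqrt (F z) * coordGradPairing G b b z +
        (Real.sqrt (F z))⁻¹ * W z * b z ^ 2) < 0 := by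
  set S : 𝔼[n] → ℝ := fun z => ∑ j, coordGrad b z j ^ 2 with hS
  have cder : ∀ j, Continuous fun z => coordGrad b z j := fun j =>
    hb.continuous_fderiv_apply (by simp) |>.comp (continuous_id.prodMk continuous_const)
  have sder : ∀ j, HasCompactSupport fun z => coordGrad b z j := fun j => hbc.fderiv_apply ℝ _
  have uder : ∀ j, tsupport (fun z => coordGrad b z j) ⊆ U := fun j =>
    (tsupport_fderiv_apply_subset ℝ _).trans hbU
  have iS : IntegrableOn S U := by
    simp only [hS, pow_two]
    exact (integrable_finsetSum _ fun j _ => integrable_mul_of_tsupport_subset hU (cder j) (sder j)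
      (uder j) (cder j).continuousOn).integrableOn
  have ib : IntegrableOn (fun z => b z ^ 2) U := by
    simp only [pow_two]
    exact (integrable_mul_of_tsupport_subset hU hb.continuous hbc hbU
      hb.continuous.continuousOn).integrableOn
  set A := ∫ z in U, S z with hA
  set B := ∫ z in U, b z ^ 2 with hB
  have hA0 : 0 ≤ A := integral_nonneg fun z => Finset.sum_nonneg fun j _ => sq_nonneg _
  have hB0 : 0 < B := by
    have h1 : B = ∫ z, b z ^ 2 := by
      refine setIntegral_eq_integral_of_forall_compl_eq_zero fun z hz => ?_
      rw [image_eq_zero_of_notMem_tsupport fun h => hz (hbU h), zero_pow two_ne_zero]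
    rw [h1]
    have h2 : HasCompactSupport fun z => b z ^ 2 := by
      simp only [pow_two]
      exact hbc.mul_right
    exact (hb.continuous.pow 2).integral_pos_of_hasCompactSupport_nonneg_nonzero h2
      (fun z => sq_nonneg _) (x := z₀) (pow_ne_zero 2 hz₀)
  set q := Real.sqrt ((C / c) ^ (n + 1)) with hq
  have hq0 : 0 ≤ q := Real.sqrt_nonneg _
  set T := 2 * q * A / c with hT
  have hT0 : 0 ≤ T := by positivity
  -- Chosen so that $\varepsilon T<\kappa B/2$; the $+1$ avoids dividing by $T$, known only to be
  -- nonnegative.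
  refine ⟨κ * B / 2 / (T + 1), by positivity, fun ε hε G F W hG hF hW hbd => ?_⟩
  have hε0 : 0 < ε := hε.1
  have hεT : ε * T < κ * B / 2 := by
    have := (lt_div_iff₀ (by positivity)).1 hε.2
    nlinarith
  set a := c / ε ^ 2 with ha
  have ha0 : 0 < a := by positivity
  set R := Real.sqrt (a ^ (n + 1)) with hR
  have hR0 : 0 < R := Real.sqrt_pos.2 (by positivity)
  have hqR : Real.sqrt ((C / ε ^ 2) ^ (n + 1)) = q * R := by
    rw [hq, hR, ← Real.sqrt_mul (by positivity), ← mul_pow, ha]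
    congr 2
    field_simp
  have hF0 : ∀ z ∈ U, 0 < F z := fun z hz => by linarith [hbd.lapse_lower z hz]
  -- The two terms have opposite signs, so the gradient term takes the upper bounds of the density
  -- and of $\sqrt F$, and the potential term the lower bounds of the density and of $1/\sqrt F$.
  have hptw : ∀ z ∈ U, Real.sqrt (G z).det * (Real.sqrt (F z) * coordGradPairing G b b z +
      (Real.sqrt (F z))⁻¹ * W z * b z ^ 2) ≤ 2 * q * R / a * S z - R * (κ * ε) / 2 * b z ^ 2 := by
    intro z hz
    have hpd := hG.posDef z hz
    have hdet := det_mem_Icc hpd.isHermitian ha0.le (hbd.form_lower z hz) (hbd.form_upper z hz)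
    have d1 : R ≤ Real.sqrt (G z).det := Real.sqrt_le_sqrt hdet.1
    have d2 : Real.sqrt (G z).det ≤ q * R := hqR ▸ Real.sqrt_le_sqrt hdet.2
    have hsF0 : 0 < Real.sqrt (F z) := Real.sqrt_pos.2 (hF0 z hz)
    have f1 : Real.sqrt (F z) ≤ 2 := by
      rw [Real.sqrt_le_left (by norm_num)]
      linarith [hbd.lapse_upper z hz]
    have f2 : 1 / 2 ≤ (Real.sqrt (F z))⁻¹ := by
      rw [one_div]
      exact inv_anti₀ hsF0 f1
    have p1 := coordGradPairing_self_le hpd ha0 (hbd.form_lower z hz) b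
    have p0 := coordGradPairing_self_nonneg hpd b
    have t1 : Real.sqrt (G z).det * (Real.sqrt (F z) * coordGradPairing G b b z) ≤
        q * R * (2 * (S z / a)) :=
      mul_le_mul d2 (mul_le_mul f1 p1 p0 (by norm_num)) (mul_nonneg hsF0.le p0) (by positivity)
    have t2 : R * (1 / 2 * (κ * ε * b z ^ 2)) ≤
        Real.sqrt (G z).det * ((Real.sqrt (F z))⁻¹ * (-W z * b z ^ 2)) := by
      have hW' : κ * ε ≤ -W z := by linarith [hbd.potential z hz]
      have w0 : 0 ≤ κ * ε * b z ^ 2 := by positivity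
      have w1 : κ * ε * b z ^ 2 ≤ -W z * b z ^ 2 := mul_le_mul_of_nonneg_right hW' (sq_nonneg _)
      exact mul_le_mul d1 (mul_le_mul f2 w1 w0 (by positivity)) (by positivity)
        (Real.sqrt_nonneg _)
    calc _ = Real.sqrt (G z).det * (Real.sqrt (F z) * coordGradPairing G b b z) -
          Real.sqrt (G z).det * ((Real.sqrt (F z))⁻¹ * (-W z * b z ^ 2)) := by ring
      _ ≤ q * R * (2 * (S z / a)) - R * (1 / 2 * (κ * ε * b z ^ 2)) := sub_le_sub t1 t2
      _ = _ := by ring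
  have cs := hF.sqrt
  have csi : ContinuousOn (fun z => (Real.sqrt (F z))⁻¹) U :=
    cs.inv₀ fun z hz => (Real.sqrt_pos.2 (hF0 z hz)).ne'
  have c0 := hG.contDiffOn_sqrt_det.continuousOn
  have i1 : IntegrableOn (fun z => Real.sqrt (G z).det * (Real.sqrt (F z) * coordGradPairing G b b z
      + (Real.sqrt (F z))⁻¹ * W z * b z ^ 2)) U := by
    have j1 : Integrable fun z => ∑ j, coordGrad b z j * (Real.sqrt (F z) * gradFlux G b j z) :=
      integrable_finsetSum _ fun j _ => integrable_mul_of_tsupport_subset hU (cder j) (sder j)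
        (uder j) (cs.mul (hG.contDiffOn_gradFlux hU hb.contDiffOn j).continuousOn)
    have j2 : Integrable fun z => b z * (Real.sqrt (G z).det * ((Real.sqrt (F z))⁻¹ *
        (W z * b z))) :=
      integrable_mul_of_tsupport_subset hU hb.continuous hbc hbU
        (c0.mul (csi.mul (hW.mul hb.continuous.continuousOn)))
    refine (j1.add j2).integrableOn.congr_fun (fun z _ => ?_) hU.measurableSet
    have e1 := sqrt_det_mul_coordGradPairing G b b z
    have e2 : ∑ j, coordGrad b z j * (Real.sqrt (F z) * gradFlux G b j z) =
        Real.sqrt (F z) * (Real.sqrt (G z).det * coordGradPairing G b b z) := by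
      rw [e1, Finset.mul_sum]
      exact Finset.sum_congr rfl fun j _ => by rw [coordGrad]; ring
    simp only [Pi.add_apply, e2]
    ring
  have i2 : IntegrableOn (fun z => 2 * q * R / a * S z - R * (κ * ε) / 2 * b z ^ 2) U :=
    (iS.const_mul _).sub (ib.const_mul _)
  refine (setIntegral_mono_on i1 i2 hU.measurableSet hptw).trans_lt ?_
  rw [integral_sub (iS.const_mul _) (ib.const_mul _), integral_const_mul, integral_const_mul]
  have hfin : 2 * q * R / a * A - R * (κ * ε) / 2 * B = R * ε * (ε * T - κ * B / 2) := by
    rw [hT, ha]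
    field_simp
  change 2 * q * R / a * A - R * (κ * ε) / 2 * B < 0
  rw [hfin]
  exact mul_neg_of_pos_of_neg (by positivity) (by linarith)

theorem unitBox_mem_nhds (c : EuclideanSpace ℝ (Fin n)) {r : ℝ} (hr : 0 < r) :
    unitBox c r ∈ 𝓝 ((headTail n).symm (3 / 2, c)) := by
  refine (isOpen_unitBox c r).mem_nhds ?_
  rw [unitBox, mem_preimage, ContinuousLinearEquiv.apply_symm_apply]
  exact ⟨⟨by norm_num, by norm_num⟩, Metric.mem_ball_self hr⟩

end AsympConic

/-! ### Bumps at dyadic scales near one boundary point -/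

theorem mainTheorem4 (n : ℕ)
    (X : Type*) [TopologicalSpace X] [ChartedSpace (EuclideanHalfSpace (n + 1)) X]
    [IsManifold (𝓡∂ (n + 1)) ∞ X] [T2Space X] [CompactSpace X]
    [MeasurableSpace X] [BorelSpace X]
    (Y : Type*) [TopologicalSpace Y] [ChartedSpace (EuclideanSpace ℝ (Fin n)) Y]
    [IsManifold (𝓡 n) ∞ Y] [T2Space Y] [CompactSpace Y] [Nonempty Y]
    (x : X → ℝ) (hx : IsBoundaryDefining (n := n) x)
    (xbar : ℝ) (hxbar : 0 < xbar) (ι : Collar n Y x xbar)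
    (δ : ℝ) (hδ : δ ∈ Ioc (0 : ℝ) 1) (M : ℝ)
    (h : Bundle.ContMDiffRiemannianMetric (𝓡 n) ∞ (EuclideanSpace ℝ (Fin n))
      (fun y : Y => TangentSpace (𝓡 n) y))
    (g : FormField n X) (hg : IsInteriorMetric g) (hconic : IsConicMetric ι δ M h g)
    (aleph : ℝ) (beth : X → ℝ) (hbeth : MemSymbol ι 0 beth)
    (hlapse : ∀ p ∈ (𝓡∂ (n + 1)).interior X, 0 < lapse x δ aleph beth p)
    (V : X → ℝ) (hV : MemSymbol ι (-(1 + δ)) V)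
    (m : ℝ) (hm : 0 < m) (haleph : aleph < 0) :
    ∃ v : ℕ → X → ℝ,
      (∀ k, ContMDiff (𝓡∂ (n + 1)) 𝓘(ℝ, ℝ) ∞ (v k)) ∧
      (∀ k, IsCompact (tsupport (v k)) ∧ tsupport (v k) ⊆ (𝓡∂ (n + 1)).interior X) ∧
      (∀ k l, k ≠ l → Disjoint (tsupport (v k)) (tsupport (v l))) ∧
      ∀ k, innerL2 (weightedVolume g x δ aleph beth) (v k) (opP g x δ aleph m beth V (v k)) < 0 := by
  obtain ⟨y₀⟩ := ‹Nonempty Y›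
  have he := chart_mem_atlas (EuclideanSpace ℝ (Fin n)) y₀
  set e := chartAt (EuclideanSpace ℝ (Fin n)) y₀
  set c := e y₀ with hc
  have hct : c ∈ e.target := e.map_source (mem_chart_source _ y₀)
  -- A single boundary point suffices: all bumps are placed in the collar above one coordinate ball
  -- around it.
  set p₀ := ι.toFun (0, e.symm c)
  have hE := chart_mem_atlas (EuclideanHalfSpace (n + 1)) p₀
  obtain ⟨r, hr, hrt, ε₁, hε₁, hsub⟩ := exists_collarParam_subset hxbar ι hct
    (chartAt (EuclideanHalfSpace (n + 1)) p₀).open_source (mem_chart_source _ p₀)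
  obtain ⟨ε₂, hε₂, c₁, hc₁, C₁, hC₁, hform⟩ :=
    paramGram_collarParam_bounds hxbar ι hδ.1 hconic he hrt
  obtain ⟨ε₃, hε₃, κ, hκ, hpot⟩ :=
    collarParam_lapse_potential_bounds hxbar ι hδ.1 hm haleph hbeth hV he hrt
  obtain ⟨b, hbU, hbc, hb, -, hb1⟩ :=
    exists_contDiff_tsupport_subset (n := ⊤) (unitBox_mem_nhds c hr)
  obtain ⟨ε₄, hε₄, hneg⟩ := exists_forall_energy_neg (isOpen_unitBox c r) hb hbc hbU
    (hb1.trans_ne one_ne_zero) hc₁ hC₁ hκ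
  have hball := Metric.ball_subset_closedBall.trans hrt
  set η := min (min ε₁ ε₂) (min ε₃ ε₄) / 2 with hη
  have hη0 : 0 < η := by positivity
  -- With ratio $1/2$ the open shells $(\varepsilon_k,2\varepsilon_k)$ may abut but never meet;
  -- disjointness of supports is then read off from the values of $x$.
  set ε : ℕ → ℝ := fun k => η * (1 / 2) ^ k with hε
  have hε0 : ∀ k, 0 < ε k := fun k => by positivity
  have hεle : ∀ k, ε k < min (min ε₁ ε₂) (min ε₃ ε₄) := fun k => by
    have h1 : ((1 : ℝ) / 2) ^ k ≤ 1 := pow_le_one₀ (by norm_num) (by norm_num)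
    have h2 : ε k ≤ η := mul_le_of_le_one_right hη0.le h1
    linarith
  have m₁ : ∀ k, ε k ∈ Ioo 0 ε₁ := fun k =>
    ⟨hε0 k, (hεle k).trans_le ((min_le_left _ _).trans (min_le_left _ _))⟩
  have m₂ : ∀ k, ε k ∈ Ioo 0 ε₂ := fun k =>
    ⟨hε0 k, (hεle k).trans_le ((min_le_left _ _).trans (min_le_right _ _))⟩
  have m₃ : ∀ k, ε k ∈ Ioo 0 ε₃ := fun k =>
    ⟨hε0 k, (hεle k).trans_le ((min_le_right _ _).trans (min_le_left _ _))⟩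
  have m₄ : ∀ k, ε k ∈ Ioo 0 ε₄ := fun k =>
    ⟨hε0 k, (hεle k).trans_le ((min_le_right _ _).trans (min_le_right _ _))⟩
  have hεx : ∀ k, 2 * ε k ≤ xbar := fun k => (hsub _ (m₁ k)).1
  have hparam : ∀ k, IsInteriorParam (collarParam ι e (ε k)) (collarCoord ι e (ε k))
      (unitBox c r) := fun k => isInteriorParam_collarParam ι hx he hball (hε0 k) (hεx k)
  have hint : ∀ k, collarParam ι e (ε k) '' unitBox c r ⊆ (𝓡∂ (n + 1)).interior X :=
    fun k => image_subset_iff.2 (hparam k).mapsTo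
  have hsupp : ∀ k, tsupport (extendZero (collarParam ι e (ε k) '' unitBox c r)
      (collarCoord ι e (ε k)) b) ⊆ collarParam ι e (ε k) '' unitBox c r := fun k =>
    (tsupport_extendZero_subset (hparam k).leftInv (hparam k).smooth.continuousOn hbc hbU).trans
      (image_mono hbU)
  have hxval : ∀ k, ∀ p ∈ collarParam ι e (ε k) '' unitBox c r, x p ∈ Ioo (ε k) (2 * ε k) := by
    rintro k _ ⟨z, hz, rfl⟩
    rw [x_collarParam ι (hε0 k) (hεx k) hz]
    constructor <;> nlinarith [hz.1.1, hz.1.2, hε0 k]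
  have hdisj : ∀ k l, k < l → Disjoint (collarParam ι e (ε k) '' unitBox c r)
      (collarParam ι e (ε l) '' unitBox c r) := by
    intro k l hkl
    refine Set.disjoint_left.2 fun p hk hl => ?_
    have h1 := (hxval k p hk).1
    have h2 := (hxval l p hl).2
    have h3 : 2 * ε l ≤ ε k := by
      have : ((1 : ℝ) / 2) ^ l ≤ (1 / 2) ^ (k + 1) :=
        pow_le_pow_of_le_one (by norm_num) (by norm_num) hkl
      have := mul_le_mul_of_nonneg_left this hη0.le
      simp only [hε]
      rw [pow_succ] at this
      linarith
    linarith
  refine ⟨fun k => extendZero (collarParam ι e (ε k) '' unitBox c r) (collarCoord ι e (ε k)) b,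
    fun k => ?_, fun k => ⟨?_, (hsupp k).trans (hint k)⟩, fun k l hkl => ?_, fun k => ?_⟩
  · exact contMDiff_extendZero (hparam k).leftInv (hparam k).smooth.continuousOn
      (hparam k).isOpen_image (hparam k).smooth_inv hb hbc hbU
  · exact hasCompactSupport_extendZero (hparam k).leftInv (hparam k).smooth.continuousOn hbc hbU
  · rcases hkl.lt_or_gt with h1 | h1
    · exact (hdisj k l h1).mono (hsupp k) (hsupp l)
    · exact ((hdisj l k h1).mono (hsupp l) (hsupp k)).symm
  · have hxs := hx.smooth.contMDiffOn (s := collarParam ι e (ε k) '' unitBox c r)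
    have hbs := hbeth.1.mono (hint k)
    have hVs := hV.1.mono (hint k)
    have hx0 : ∀ p ∈ collarParam ι e (ε k) '' unitBox c r, 0 < x p :=
      fun p hp => (hε0 k).trans (hxval k p hp).1
    rw [(hparam k).innerL2_opP_eq hg hE (hsub _ (m₁ k)).2 hxs hx0 hbs hVs
      (fun p hp => hlapse p (hint k hp)) hb hbc hbU]
    refine hneg _ (m₄ k) _ _ _ ((hparam k).isMetricOn hg) ?_ ?_
      ⟨fun z hz w => (hform _ (m₂ k) z hz w).1, fun z hz w => (hform _ (m₂ k) z hz w).2,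
        fun z hz => (hpot _ (m₃ k) z hz).1, fun z hz => (hpot _ (m₃ k) z hz).2.1,
        fun z hz => (hpot _ (m₃ k) z hz).2.2⟩
    · exact ((hparam k).contDiffOn_lapse δ aleph hxs hx0 hbs).continuousOn
    · exact ((hparam k).contDiffOn_effPotential δ aleph m hxs hx0 hbs hVs).continuousOn
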